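/- Let $T=(\mathbb C^*)^n$ with character group $\widehat T\cong\mathbb Z^n$ (written additively), and let $R(T)$ be its representation ring, the free $\mathbb Z$-module on symbols $e^{\mu}$, $\mu\in\widehat T$, with $e^\mu e^\nu=e^{\mu+\nu}$. Let $V$ be a finite-dimensional rational representation of $T$, with set of weights $\Phi$. Assume that all weight spaces $V_\beta$, $\beta\in\Phi$, are one-dimensional and that $\Phi$ lies in an open half-space of the real span of $\widehat T$ (there is a linear functional $\ell$ with $\ell(\beta)>0$ for all $\beta\in\Phi$). For $\beta\in\Phi$ let $x_\beta\in V^*$ be a nonzero vector of weight $-\beta$, so that $\mathbb C[V]=\mathbb C[x_\beta,\ \beta\in\Phi]$. Let $Y\subseteq V$ be a $T$-stable closed subscheme containing the origin $0$, let $\mathfrak m$ be the maximal ideal of the local ring $\mathcal O_{Y,0}$, and put $$B=\operatorname{Sym}(\mathfrak m/\mathfrak m^2),\qquad C=\bigoplus_{i\ge 0}\mathfrak m^i/\mathfrak m^{i+1},\qquad T_0Y=(\mathfrak m/\mathfrak m^2)^*,$$ with degree-one parts $B_1=C_1=\mathfrak m/\mathfrak m^2$. Let $K_T(V)$ be the Grothendieck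 group of $T$-equivariant coherent sheaves on $V$, and $i_0^*:K_T(V)\to R(T)$ the pullback along the inclusion of the origin, i.e. the unique group homomorphism which takes the class $[E]$ of every $T$-equivariant vector bundle $E$ to the class $\sum_\mu \dim (E_0)_\mu\, e^\mu$ of its fibre $E_0$ at $0$ (it exists and is unique). Let $[\mathcal O_Y]\in K_T(V)$ be the class of the structure sheaf of $Y$. Let $\alpha\in\Phi$ be integrally indecomposable, i.e. not a positive integer linear combination of elements of $\Phi\setminus\{\alpha\}$. Then the following are equivalent: (i) $\alpha$ is a weight of $T_0Y$; (ii) $x_\alpha\in B_1$, i.e. the image of $x_\alpha$ under $\operatorname{Sym}(V^*)\to B$ is nonzero; (iii) $x_\alpha\in C_1$, i.e. the image of $x_\alpha$ under $\operatorname{Sym}(V^*)\to C$ is nonzero; (iv) $-\alpha$ is a weight of $C$; (v) $1-e^{-\alpha}$ is not a simple factor of $i_0^*[\mathcal O_Y]$, i.e. there is no $Q$ in the subring $\mathbb Z[e^{-\beta},\ \beta\in\Phi\setminus\{\alpha\}]$ of $R(T)$ with $i_0^*[\mathcal O_Y]=(1-e^{-\alpha})\,Q$. -/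

import Mathlib

open scoped DirectSum

universe u

noncomputable section

/-! ### The torus, its characters, rational representations, weights -/

/-- The torus `T = (ℂ^*)^n`. -/
abbrev Torus (n : ℕ) : Type := Fin n → ℂˣ

/-- The character group of `T`, written additively: `μ = (μ₁, …, μₙ)` stands for the
character `e^μ : t ↦ t₁ ^ μ₁ ⋯ tₙ ^ μₙ`. -/
abbrev CharGroup (n : ℕ) : Type := Fin n → ℤ

/-- The homomorphism `e^μ : T → ℂ^*`. -/
def expChar {n : ℕ} (μ : CharGroup n) : Torus n →* ℂˣ where
  toFun t := ∏ i, t i ^ μ i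
  map_one' := by simp
  map_mul' s t := by simp [mul_zpow, Finset.prod_mul_distrib]

theorem expChar_zero {n : ℕ} (t : Torus n) : expChar (0 : CharGroup n) t = 1 := by
  simp [expChar]

theorem expChar_add {n : ℕ} (μ ν : CharGroup n) (t : Torus n) :
    expChar (μ + ν) t = expChar μ t * expChar ν t := by
  simp [expChar, zpow_add, Finset.prod_mul_distrib]

theorem expChar_neg_inv {n : ℕ} (μ : CharGroup n) (t : Torus n) :
    expChar (-μ) t = expChar μ t⁻¹ := by
  simp [expChar]

section Rep

section Weights

variable {n : ℕ} {M : Type*} [AddCommMonoid M] [Module ℂ M]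

/-- The weight space `M_μ = {m | t • m = e^μ(t) m for all t}`. -/
def weightSpace (τ : Representation ℂ (Torus n) M) (μ : CharGroup n) : Submodule ℂ M where
  carrier := {m | ∀ t, τ t m = (expChar μ t : ℂ) • m}
  add_mem' ha hb t := by rw [map_add, ha t, hb t, smul_add]
  zero_mem' t := by simp
  smul_mem' c m hm t := by rw [map_smul, hm t, smul_comm]

/-- The set `Φ(M)` of weights of `T` on `M`. -/
def weights (τ : Representation ℂ (Torus n) M) : Set (CharGroup n) :=
  {μ | weightSpace τ μ ≠ ⊥}

end Weights

variable {n : ℕ} {M : Type*} [AddCommGroup M] [Module ℂ M]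

/-- A function `T → M` which is a Laurent polynomial in `t₁, …, tₙ` with coefficients in `M`. -/
def IsLaurent (φ : Torus n → M) : Prop :=
  ∃ c : CharGroup n →₀ M, ∀ t, φ t = c.sum fun μ m => (expChar μ t : ℂ) • m

/-- Rational (i.e. algebraic) representations: every orbit map `t ↦ t • m` is a Laurent
polynomial with coefficients in `M`, i.e. `M` is a comodule over `ℂ[T]`. -/
def IsRational (τ : Representation ℂ (Torus n) M) : Prop :=
  ∀ m, IsLaurent fun t => τ t m

theorem IsLaurent.single (μ : CharGroup n) (m : M) :
    IsLaurent fun t : Torus n => (expChar μ t : ℂ) • m :=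
  ⟨Finsupp.single μ m, fun t => by simp⟩

theorem IsLaurent.zero : IsLaurent fun _ : Torus n => (0 : M) := ⟨0, fun t => by simp⟩

theorem IsLaurent.add {φ ψ : Torus n → M} (hφ : IsLaurent φ) (hψ : IsLaurent ψ) :
    IsLaurent fun t => φ t + ψ t := by
  classical
  obtain ⟨c, hc⟩ := hφ
  obtain ⟨d, hd⟩ := hψ
  refine ⟨c + d, fun t => ?_⟩
  rw [Finsupp.sum_add_index' (by simp) (by simp [smul_add]), ← hc, ← hd]

theorem IsLaurent.sum {ι : Type*} (s : Finset ι) {φ : ι → Torus n → M}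
    (h : ∀ i ∈ s, IsLaurent (φ i)) : IsLaurent fun t => ∑ i ∈ s, φ i t := by
  classical
  induction s using Finset.induction_on with
  | empty => simpa using IsLaurent.zero
  | insert a s ha ih =>
    simp only [Finset.sum_insert ha]
    exact (h a (by simp)).add (ih fun i hi => h i (by simp [hi]))

theorem IsLaurent.map {N : Type*} [AddCommGroup N] [Module ℂ N] {φ : Torus n → M}
    (h : IsLaurent φ) (g : M →ₗ[ℂ] N) : IsLaurent fun t => g (φ t) := by
  obtain ⟨c, hc⟩ := h
  simp only [hc, Finsupp.sum, map_sum, map_smul]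
  exact IsLaurent.sum _ fun μ _ => IsLaurent.single _ _

theorem IsLaurent.mul {A : Type*} [CommRing A] [Algebra ℂ A] {φ ψ : Torus n → A}
    (hφ : IsLaurent φ) (hψ : IsLaurent ψ) : IsLaurent fun t => φ t * ψ t := by
  obtain ⟨c, hc⟩ := hφ
  obtain ⟨d, hd⟩ := hψ
  simp only [hc, hd, Finsupp.sum, Finset.sum_mul_sum]
  refine IsLaurent.sum _ fun μ _ => IsLaurent.sum _ fun ν _ => ?_
  have := IsLaurent.single (n := n) (μ + ν) (c μ * d ν)
  simpa only [expChar_add, smul_mul_smul_comm, Units.val_mul] using this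

theorem IsRational.dual [FiniteDimensional ℂ M] {τ : Representation ℂ (Torus n) M}
    (h : IsRational τ) : IsRational τ.dual := by
  classical
  intro ξ
  let b := Module.finBasis ℂ M
  choose c hc using fun j => h (b j)
  have key : ∀ t : Torus n, τ.dual t ξ =
      ∑ j, ∑ μ ∈ (c j).support, (expChar (-μ) t : ℂ) • (ξ (c j μ) • b.coord j) := by
    intro t
    refine b.ext fun i => ?_
    rw [Representation.dual_apply, Module.Dual.transpose_apply, LinearMap.comp_apply,
      show τ t⁻¹ (b i) = _ from hc i t⁻¹]
    simp only [Finsupp.sum, map_sum, map_smul, LinearMap.sum_apply, LinearMap.smul_apply,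
      Module.Basis.coord_apply, Module.Basis.repr_self, smul_eq_mul, expChar_neg_inv]
    rw [Finset.sum_eq_single i]
    · simp
    · intro j _ hj
      simp [hj.symm]
    · simp
  simp only [key]
  exact IsLaurent.sum _ fun j _ => IsLaurent.sum _ fun μ _ => IsLaurent.single _ _

end Rep

/-! ### The representation ring -/

/-- The representation ring `R(T)`: the free `ℤ`-module on the symbols `e^μ`, with
`e^μ e^ν = e^(μ + ν)`. -/
abbrev RepRing (n : ℕ) : Type := AddMonoidAlgebra ℤ (CharGroup n)

/-- The basis element `e^μ` of `R(T)`. -/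
def expR {n : ℕ} (μ : CharGroup n) : RepRing n := AddMonoidAlgebra.single μ 1

/-- The class `[M] = ∑_μ (dim M_μ) e^μ` in `R(T)` of a finite-dimensional rational
representation `M` (whose set of weights is finite). -/
def repClass {n : ℕ} {M : Type*} [AddCommGroup M] [Module ℂ M]
    (τ : Representation ℂ (Torus n) M) : RepRing n :=
  ∑ᶠ μ : CharGroup n, (Module.finrank ℂ (weightSpace τ μ) : ℤ) • expR μ

/-- The subring `ℤ[e^{-μ}, μ ∈ S]` of `R(T)`. -/
def expSubring {n : ℕ} (S : Set (CharGroup n)) : Subring (RepRing n) :=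
  Subring.closure ((fun μ => expR (-μ)) '' S)

/-- `1 - e^{-α}` is a simple factor of `P` (with respect to the set of weights `Φ`):
`P = (1 - e^{-α}) Q` with `Q ∈ ℤ[e^{-μ}, μ ∈ Φ \ {α}]`. -/
def IsSimpleFactor {n : ℕ} (Φ : Set (CharGroup n)) (α : CharGroup n) (P : RepRing n) : Prop :=
  ∃ Q ∈ expSubring (Φ \ {α}), P = (1 - expR (-α)) * Q

/-- `α` is a positive integer linear combination of elements of `Φ` other than `α`. -/
def IntegrallyDecomposable {n : ℕ} (Φ : Set (CharGroup n)) (α : CharGroup n) : Prop :=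
  ∃ (s : Finset (CharGroup n)) (c : CharGroup n → ℕ), s.Nonempty ∧ (s : Set (CharGroup n)) ⊆ Φ \ {α} ∧
    (∀ β ∈ s, 0 < c β) ∧ α = ∑ β ∈ s, c β • β

/-- `Φ` lies in an open half-space of the real span of the characters. -/
def InHalfSpace {n : ℕ} (Φ : Set (CharGroup n)) : Prop :=
  ∃ ℓ : (Fin n → ℝ) →ₗ[ℝ] ℝ, ∀ α ∈ Φ, 0 < ℓ fun i => (α i : ℝ)

/-! ### Actions on algebras -/

/-- The representation underlying an action of `T` by algebra endomorphisms. -/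
def algRep {n : ℕ} {A : Type*} [CommRing A] [Algebra ℂ A] (σ : Torus n →* (A →ₐ[ℂ] A)) :
    Representation ℂ (Torus n) A where
  toFun t := (σ t).toLinearMap
  map_one' := by rw [map_one]; rfl
  map_mul' s t := by rw [map_mul]; rfl

section LocalAlgebra

variable {n : ℕ} (A : Type*) [CommRing A] [IsLocalRing A] [Algebra ℂ A]

/-- The power `𝔪^i` of the maximal ideal of a local algebra, as a complex vector space. -/
def powSubspace (i : ℕ) : Submodule ℂ A := (IsLocalRing.maximalIdeal A ^ i).restrictScalars ℂ

/-- `𝔪^{i+1}` as a subspace of `𝔪^i`. -/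
def powSucc (i : ℕ) : Submodule ℂ (powSubspace A i) :=
  (powSubspace A (i + 1)).submoduleOf (powSubspace A i)

variable {A} (σ : Torus n →* (A →ₐ[ℂ] A))

theorem act_mem_maximalIdeal (t : Torus n) {f : A} (hf : f ∈ IsLocalRing.maximalIdeal A) :
    σ t f ∈ IsLocalRing.maximalIdeal A := by
  rw [IsLocalRing.mem_maximalIdeal, mem_nonunits_iff] at hf ⊢
  intro h
  apply hf
  have h2 : σ t⁻¹ (σ t f) = f := by
    rw [← AlgHom.mul_apply, ← map_mul, inv_mul_cancel, map_one]
    rfl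
  rw [← h2]
  exact h.map (σ t⁻¹)

theorem powSubspace_stable (i : ℕ) (t : Torus n) :
    powSubspace A i ≤ (powSubspace A i).comap (algRep σ t) := by
  intro f hf
  have h1 : (IsLocalRing.maximalIdeal A ^ i).map (σ t : A →+* A) ≤
      IsLocalRing.maximalIdeal A ^ i := by
    rw [Ideal.map_pow]
    refine Ideal.pow_right_mono (Ideal.map_le_iff_le_comap.2 fun x hx => ?_) i
    exact act_mem_maximalIdeal σ t hx
  exact h1 (Ideal.mem_map_of_mem _ hf)

/-- The representation of `T` on `𝔪^i`. -/
def powRep (i : ℕ) : Representation ℂ (Torus n) (powSubspace A i) :=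
  (algRep σ).subrepresentation (powSubspace A i) (powSubspace_stable σ i)

theorem powSucc_stable (i : ℕ) (t : Torus n) :
    powSucc A i ≤ (powSucc A i).comap (powRep σ i t) :=
  fun f hf => powSubspace_stable σ (i + 1) t (x := (f : A)) hf

end LocalAlgebra

/-- The coordinate ring `ℂ[V] = Sym(V^*)`. -/
abbrev CoordRing (V : Type u) [AddCommGroup V] [Module ℂ V] : Type u :=
  SymmetricAlgebra ℂ (Module.Dual ℂ V)

/-- Evaluation at the origin, `ℂ[V] → ℂ`. -/
def evalZero (V : Type u) [AddCommGroup V] [Module ℂ V] : CoordRing V →ₐ[ℂ] ℂ :=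
  SymmetricAlgebra.algebraMapInv

theorem evalZero_ι {V : Type u} [AddCommGroup V] [Module ℂ V] (ξ : Module.Dual ℂ V) :
    evalZero V (SymmetricAlgebra.ι ℂ _ ξ) = 0 :=
  SymmetricAlgebra.algebraMapInv_ι ξ

/-- The maximal ideal of the origin in `ℂ[V]`. -/
def originIdeal (V : Type u) [AddCommGroup V] [Module ℂ V] : Ideal (CoordRing V) :=
  RingHom.ker (evalZero V)

section Geometry

variable {n : ℕ} {V : Type u} [AddCommGroup V] [Module ℂ V]

/-- The action of `T` on `ℂ[V] = Sym(V^*)`, induced by the dual representation. -/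
def coordAct (ρ : Representation ℂ (Torus n) V) : Torus n →* (CoordRing V →ₐ[ℂ] CoordRing V) where
  toFun t := SymmetricAlgebra.lift (SymmetricAlgebra.ι ℂ (Module.Dual ℂ V) ∘ₗ ρ.dual t)
  map_one' := by
    apply SymmetricAlgebra.algHom_ext
    ext x
    rw [map_one]
    simp
  map_mul' s t := by
    apply SymmetricAlgebra.algHom_ext
    ext x
    rw [map_mul]
    simp

theorem coordAct_ι (ρ : Representation ℂ (Torus n) V) (t : Torus n) (ξ : Module.Dual ℂ V) :
    coordAct ρ t (SymmetricAlgebra.ι ℂ _ ξ) = SymmetricAlgebra.ι ℂ _ (ρ.dual t ξ) := by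
  simp [coordAct]

theorem evalZero_coordAct (ρ : Representation ℂ (Torus n) V) (t : Torus n) (f : CoordRing V) :
    evalZero V (coordAct ρ t f) = evalZero V f := by
  have : (evalZero V).comp (coordAct ρ t) = evalZero V := by
    apply SymmetricAlgebra.algHom_ext
    ext x
    change evalZero V (coordAct ρ t (SymmetricAlgebra.ι ℂ _ x)) =
      evalZero V (SymmetricAlgebra.ι ℂ _ x)
    rw [coordAct_ι, evalZero_ι, evalZero_ι]
  exact DFunLike.congr_fun this f

theorem coordAct_mem_originIdeal (ρ : Representation ℂ (Torus n) V) (t : Torus n)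
    {f : CoordRing V} (hf : f ∈ originIdeal V) : coordAct ρ t f ∈ originIdeal V := by
  have h : evalZero V f = 0 := hf
  change evalZero V (coordAct ρ t f) = 0
  rw [evalZero_coordAct, h]

theorem isRational_coord [FiniteDimensional ℂ V] {ρ : Representation ℂ (Torus n) V}
    (hρ : IsRational ρ) : IsRational (algRep (coordAct ρ)) := by
  intro f
  change IsLaurent fun t => coordAct ρ t f
  induction f using SymmetricAlgebra.induction with
  | algebraMap r =>
    have := IsLaurent.single (n := n) 0 (algebraMap ℂ (CoordRing V) r)
    simpa [expChar_zero] using this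
  | ι x =>
    simp only [coordAct_ι]
    exact (hρ.dual x).map _
  | mul a b ha hb =>
    simp only [map_mul]
    exact ha.mul hb
  | add a b ha hb =>
    simp only [map_add]
    exact ha.add hb

/-! ### Equivariant coherent sheaves on `V` and `K_T(V)` -/

/-- A `T`-equivariant coherent sheaf on the affine scheme `V`: a finitely generated
`ℂ[V]`-module with a compatible rational action of `T`. -/
structure EquivModule (ρ : Representation ℂ (Torus n) V) : Type (u + 1) where
  carrier : Type u
  [addCommGroup : AddCommGroup carrier]
  [moduleC : Module ℂ carrier]
  [module : Module (CoordRing V) carrier]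
  [isScalarTower : IsScalarTower ℂ (CoordRing V) carrier]
  [finite : Module.Finite (CoordRing V) carrier]
  rep : Representation ℂ (Torus n) carrier
  rep_smul : ∀ (t : Torus n) (f : CoordRing V) (m : carrier),
    rep t (f • m) = coordAct ρ t f • rep t m
  rational : IsRational rep

attribute [instance] EquivModule.addCommGroup EquivModule.moduleC EquivModule.module
  EquivModule.isScalarTower EquivModule.finite

variable {ρ : Representation ℂ (Torus n) V}

/-- `0 → M' → M → M'' → 0` can be completed to a short exact sequence of equivariant modules. -/
def IsShortExact (M' M M'' : EquivModule ρ) : Prop :=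
  ∃ (f : M'.carrier →ₗ[CoordRing V] M.carrier) (g : M.carrier →ₗ[CoordRing V] M''.carrier),
    (∀ t m, f (M'.rep t m) = M.rep t (f m)) ∧ (∀ t m, g (M.rep t m) = M''.rep t (g m)) ∧
    Function.Injective f ∧ Function.Exact f g ∧ Function.Surjective g

/-- The relations `[M] = [M'] + [M'']` for short exact sequences `0 → M' → M → M'' → 0`. -/
def exactRelations (ρ : Representation ℂ (Torus n) V) :
    AddSubgroup (FreeAbelianGroup (EquivModule ρ)) :=
  AddSubgroup.closure {z | ∃ M' M M'' : EquivModule ρ, IsShortExact M' M M'' ∧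
    z = FreeAbelianGroup.of M - FreeAbelianGroup.of M' - FreeAbelianGroup.of M''}

/-- `K_T(V)`, the Grothendieck group of `T`-equivariant coherent sheaves on `V`. -/
abbrev KGroup (ρ : Representation ℂ (Torus n) V) : Type (u + 1) :=
  FreeAbelianGroup (EquivModule ρ) ⧸ exactRelations ρ

/-- The class `[M]` in `K_T(V)`. -/
def EquivModule.kClass (M : EquivModule ρ) : KGroup ρ :=
  QuotientAddGroup.mk (FreeAbelianGroup.of M)

/-- The submodule `𝔫 M`, where `𝔫` is the maximal ideal of the origin. -/
def EquivModule.originSubmodule (M : EquivModule ρ) : Submodule ℂ M.carrier :=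
  (originIdeal V • (⊤ : Submodule (CoordRing V) M.carrier)).restrictScalars ℂ

theorem EquivModule.originSubmodule_stable (M : EquivModule ρ) (t : Torus n) :
    M.originSubmodule ≤ M.originSubmodule.comap (M.rep t) := by
  intro m hm
  change m ∈ originIdeal V • (⊤ : Submodule (CoordRing V) M.carrier) at hm
  change M.rep t m ∈ originIdeal V • (⊤ : Submodule (CoordRing V) M.carrier)
  induction hm using Submodule.smul_induction_on' with
  | smul f hf x _ =>
    rw [M.rep_smul]
    exact Submodule.smul_mem_smul (coordAct_mem_originIdeal ρ t hf) trivial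
  | add x _ y _ hx hy =>
    rw [map_add]
    exact Submodule.add_mem _ hx hy

/-- The representation of `T` on the fibre `M / 𝔫 M` at the origin. -/
def EquivModule.fibreRep (M : EquivModule ρ) :
    Representation ℂ (Torus n) (M.carrier ⧸ M.originSubmodule) :=
  M.rep.quotient M.originSubmodule M.originSubmodule_stable

/-- A homomorphism `K_T(V) → R(T)` is the pullback `i_0^*` along the inclusion of the origin if it
takes the class of every `T`-equivariant vector bundle (finitely generated projective
equivariant module) to the class of its fibre at the origin. -/
def IsPullbackToOrigin (f : KGroup ρ →+ RepRing n) : Prop :=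
  ∀ E : EquivModule ρ, Module.Projective (CoordRing V) E.carrier →
    f E.kClass = repClass E.fibreRep

/-! ### Stable closed subschemes -/

/-- A `T`-stable closed subscheme `Y` of `V` through the origin, given by its ideal. -/
structure StableSubscheme (ρ : Representation ℂ (Torus n) V) where
  ideal : Ideal (CoordRing V)
  stable : ∀ (t : Torus n), ∀ f ∈ ideal, coordAct ρ t f ∈ ideal
  zero_mem : ideal ≤ originIdeal V

namespace StableSubscheme

variable (Y : StableSubscheme ρ)

/-- The coordinate ring `ℂ[Y]`. -/
abbrev ring : Type u := CoordRing V ⧸ Y.ideal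

/-- The action of `T` on `ℂ[Y]`. -/
def act : Torus n →* (Y.ring →ₐ[ℂ] Y.ring) where
  toFun t := Ideal.quotientMapₐ Y.ideal (coordAct ρ t) (fun f hf => Y.stable t f hf)
  map_one' := by
    apply Ideal.Quotient.algHom_ext
    ext x
    simp
  map_mul' s t := by
    apply Ideal.Quotient.algHom_ext
    ext x
    change Ideal.Quotient.mk Y.ideal (coordAct ρ (s * t) _) =
      Ideal.Quotient.mk Y.ideal (coordAct ρ s (coordAct ρ t _))
    rw [map_mul]
    rfl

theorem act_mk (t : Torus n) (f : CoordRing V) :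
    Y.act t (Ideal.Quotient.mk Y.ideal f) = Ideal.Quotient.mk Y.ideal (coordAct ρ t f) := rfl

/-- The structure sheaf `𝒪_Y` as an equivariant coherent sheaf on `V`. -/
def structureSheaf [FiniteDimensional ℂ V] (hρ : IsRational ρ) : EquivModule ρ where
  carrier := Y.ring
  moduleC := Algebra.toModule
  module := Algebra.toModule
  rep := algRep Y.act
  rep_smul t f m := by
    obtain ⟨g, rfl⟩ := Ideal.Quotient.mk_surjective m
    change Ideal.Quotient.mk Y.ideal (coordAct ρ t (f * g)) =
      Ideal.Quotient.mk Y.ideal (coordAct ρ t f * coordAct ρ t g)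
    rw [map_mul]
  rational m := by
    obtain ⟨f, rfl⟩ := Ideal.Quotient.mk_surjective m
    exact (isRational_coord hρ f).map (Ideal.Quotient.mkₐ ℂ Y.ideal).toLinearMap

/-- Evaluation at the origin, `ℂ[Y] → ℂ`. -/
def eval : Y.ring →ₐ[ℂ] ℂ :=
  Ideal.Quotient.liftₐ Y.ideal (evalZero V) (fun _ hf => Y.zero_mem hf)

theorem eval_act (t : Torus n) (g : Y.ring) : Y.eval (Y.act t g) = Y.eval g := by
  obtain ⟨f, rfl⟩ := Ideal.Quotient.mk_surjective g
  exact evalZero_coordAct ρ t f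

/-- The maximal ideal of the origin in `ℂ[Y]`. -/
def pointIdeal : Ideal Y.ring := RingHom.ker Y.eval

instance : Y.pointIdeal.IsPrime := RingHom.ker_isPrime _

theorem pointIdeal_comap (t : Torus n) :
    Y.pointIdeal = Y.pointIdeal.comap (Y.act t : Y.ring →+* Y.ring) := by
  ext g
  change Y.eval g = 0 ↔ Y.eval (Y.act t g) = 0
  rw [eval_act]

/-- The local ring of `Y` at the origin. -/
def localRing : Type u := Localization.AtPrime Y.pointIdeal

instance : CommRing Y.localRing := inferInstanceAs (CommRing (Localization.AtPrime Y.pointIdeal))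

instance : Algebra Y.ring Y.localRing :=
  inferInstanceAs (Algebra Y.ring (Localization.AtPrime Y.pointIdeal))

instance : Algebra ℂ Y.localRing :=
  inferInstanceAs (Algebra ℂ (Localization.AtPrime Y.pointIdeal))

instance : IsScalarTower ℂ Y.ring Y.localRing :=
  inferInstanceAs (IsScalarTower ℂ Y.ring (Localization.AtPrime Y.pointIdeal))

instance : IsLocalization.AtPrime Y.localRing Y.pointIdeal :=
  inferInstanceAs (IsLocalization.AtPrime (Localization.AtPrime Y.pointIdeal) Y.pointIdeal)

instance : IsLocalRing Y.localRing :=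
  inferInstanceAs (IsLocalRing (Localization.AtPrime Y.pointIdeal))

/-- The ring endomorphism of the local ring given by an element of `T`. -/
def localActHom (t : Torus n) : Y.localRing →+* Y.localRing :=
  Localization.localRingHom Y.pointIdeal Y.pointIdeal (Y.act t : Y.ring →+* Y.ring)
    (Y.pointIdeal_comap t)

theorem localActHom_algebraMap (t : Torus n) (g : Y.ring) :
    Y.localActHom t (algebraMap Y.ring Y.localRing g) =
      algebraMap Y.ring Y.localRing (Y.act t g) :=
  Localization.localRingHom_to_map _ _ _ (Y.pointIdeal_comap t) g

theorem localHom_ext {f g : Y.localRing →ₐ[ℂ] Y.localRing}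
    (h : ∀ x : Y.ring, f (algebraMap Y.ring Y.localRing x) = g (algebraMap Y.ring Y.localRing x)) :
    f = g := by
  apply AlgHom.coe_ringHom_injective
  apply IsLocalization.ringHom_ext Y.pointIdeal.primeCompl
  ext x
  exact h x

/-- The action of `T` on the local ring of `Y` at the origin. -/
def localAct : Torus n →* (Y.localRing →ₐ[ℂ] Y.localRing) where
  toFun t :=
    { Y.localActHom t with
      commutes' := fun r => by
        change Y.localActHom t (algebraMap ℂ Y.localRing r) = _
        rw [IsScalarTower.algebraMap_apply ℂ Y.ring Y.localRing, localActHom_algebraMap,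
          AlgHom.commutes] }
  map_one' := by
    refine Y.localHom_ext fun x => ?_
    change Y.localActHom 1 (algebraMap Y.ring Y.localRing x) = _
    rw [localActHom_algebraMap, map_one]
    rfl
  map_mul' s t := by
    refine Y.localHom_ext fun x => ?_
    change Y.localActHom (s * t) (algebraMap Y.ring Y.localRing x) =
      Y.localActHom s (Y.localActHom t (algebraMap Y.ring Y.localRing x))
    rw [localActHom_algebraMap, localActHom_algebraMap, localActHom_algebraMap, map_mul]
    rfl

theorem localAct_algebraMap (t : Torus n) (g : Y.ring) :
    Y.localAct t (algebraMap Y.ring Y.localRing g) =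
      algebraMap Y.ring Y.localRing (Y.act t g) :=
  Y.localActHom_algebraMap t g

/-- The power `𝔪^i` of the maximal ideal `𝔪` of the local ring, as a complex vector space. -/
abbrev maxPow (i : ℕ) : Submodule ℂ Y.localRing := powSubspace Y.localRing i

/-- The graded piece `𝔪^i / 𝔪^{i+1}`; for `i = 1` the cotangent space `𝔪 / 𝔪²`. -/
abbrev grPiece (i : ℕ) : Type u := Y.maxPow i ⧸ powSucc Y.localRing i

/-- The representation of `T` on `𝔪^i / 𝔪^{i+1}`. -/
def grRep (i : ℕ) : Representation ℂ (Torus n) (Y.grPiece i) :=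
  (powRep Y.localAct i).quotient (powSucc Y.localRing i) (powSucc_stable Y.localAct i)

/-- The representation of `T` on the tangent space `T_0 Y = (𝔪 / 𝔪²)^*`. -/
def tangentRep : Representation ℂ (Torus n) (Module.Dual ℂ (Y.grPiece 1)) :=
  (Y.grRep 1).dual

/-- `B = Sym(𝔪 / 𝔪²)`, the coordinate ring of the tangent space. -/
abbrev tangentRing : Type u := SymmetricAlgebra ℂ (Y.grPiece 1)

/-- `C = ⨁_i 𝔪^i / 𝔪^{i+1}`, the coordinate ring of the tangent cone (as a representation of `T`). -/
abbrev coneRing : Type u := ⨁ i : ℕ, Y.grPiece i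

/-- The representation of `T` on `C`. -/
def coneRep : Representation ℂ (Torus n) Y.coneRing := Representation.directSum Y.grRep

/-- The image of a linear function on `V` in the local ring of `Y` at the origin. -/
def linearGerm : Module.Dual ℂ V →ₗ[ℂ] Y.localRing :=
  (IsScalarTower.toAlgHom ℂ Y.ring Y.localRing).toLinearMap ∘ₗ
    (Ideal.Quotient.mkₐ ℂ Y.ideal).toLinearMap ∘ₗ SymmetricAlgebra.ι ℂ (Module.Dual ℂ V)

theorem linearGerm_mem (ξ : Module.Dual ℂ V) : Y.linearGerm ξ ∈ Y.maxPow 1 := by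
  change algebraMap Y.ring Y.localRing _ ∈ IsLocalRing.maximalIdeal Y.localRing ^ 1
  rw [pow_one]
  refine (IsLocalization.AtPrime.to_map_mem_maximal_iff Y.localRing Y.pointIdeal _).2 ?_
  exact evalZero_ι ξ

/-- The canonical map `V^* = 𝔫 / 𝔫² → 𝔪 / 𝔪²`. -/
def cotangentMap : Module.Dual ℂ V →ₗ[ℂ] Y.grPiece 1 :=
  (powSucc Y.localRing 1).mkQ ∘ₗ Y.linearGerm.codRestrict (Y.maxPow 1) Y.linearGerm_mem

/-- The restriction of a linear function on `V` to the tangent space, an element of `B₁ ⊆ B`. -/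
def toTangentRing : Module.Dual ℂ V →ₗ[ℂ] Y.tangentRing :=
  SymmetricAlgebra.ι ℂ (Y.grPiece 1) ∘ₗ Y.cotangentMap

/-- The restriction of a linear function on `V` to the tangent cone, an element of `C₁ ⊆ C`. -/
def toConeRing : Module.Dual ℂ V →ₗ[ℂ] Y.coneRing :=
  DirectSum.lof ℂ ℕ Y.grPiece 1 ∘ₗ Y.cotangentMap

end StableSubscheme

end Geometry

end

/-! A rational representation is the sum of its weight spaces, so everything reduces to asking which
weights occur where. Let `b` be a basis of weight vectors of V with weights `β i`, and let α = `β
i₀`. The coordinate functions then have weights `-β i`, and all of ℂ[V], ℂ[Y] and the pieces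
𝔪^k/𝔪^(k+1) are spanned by monomials in them. Applying a functional ℓ that is positive on Φ shows
that, α being indecomposable, the only monomial of weight -α is `x_α` itself (`eq_single_of_sum_eq`,
`eq_one_of_sum_neg_eq`).

Hence (i) and (iv) each say that the class of `x_α` in 𝔪/𝔪² is nonzero. So do (ii) and (iii),
because the degree-one parts embed in B and C. This class vanishes exactly when `x_α` lies in the
ideal of Y: vanishing puts `x_α` in the square of the ideal of the origin in ℂ[Y], hence in the span
of monomials of degree at least two, and a nonzero element of weight -α cannot lie there
(`coordX_mem_ideal`).

For (v), the pullback is computed by characters. The character of an equivariant coherent module is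
a function on the character group with ℓ bounded above on its support, and R(T) acts on such
functions by convolution. By a Hilbert–Serre argument, ∏(1 - e^{-β}) · char M is a Laurent
polynomial (`exists_eulerProd_charFun`). It is additive in M, and on a vector bundle it gives the
fibre at 0, since the coordinates form a regular sequence. This proves existence of the pullback.
Uniqueness holds because vector bundles generate K_T(V): taking syzygies d = dim V times gives a
module on which the coordinates are regular, which is free by graded Nakayama
(`projective_of_regularUpTo`, `kClass_mem_closure`).

If `x_α` vanishes on Y, the Hilbert–Serre argument for the remaining coordinates yields the cofactor
Q, supported in the cone spanned by -β for β ≠ α. Conversely, in a factorization the factor 1 -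
e^{-α} can be cancelled, as it acts injectively on functions with support bounded above. The
remaining factors can be divided out without leaving that cone. So the weights of ℂ[Y] lie in the
cone, -α is not among them, and `x_α` vanishes on Y (`isSimpleFactor_iff`). -/

noncomputable section

/-! ### Weight decomposition of rational representations -/

section WeightTheory

variable {n : ℕ} {M M' M'' : Type*} [AddCommGroup M] [Module ℂ M] [AddCommGroup M'] [Module ℂ M']
  [AddCommGroup M''] [Module ℂ M'']

theorem expChar_injective :
    Function.Injective (expChar : CharGroup n → (Torus n →* ℂˣ)) := by
  classical
  intro μ ν h
  funext i
  -- Evaluating at 2 in the i-th slot gives 2 ^ μ i; norms reduce to injectivity of integer powers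
  -- of the real number 2.
  have h2 := DFunLike.congr_fun h (Pi.mulSingle i (Units.mk0 (2 : ℂ) two_ne_zero))
  have key : ∀ κ : CharGroup n, expChar κ (Pi.mulSingle i (Units.mk0 (2 : ℂ) two_ne_zero)) =
      (Units.mk0 (2 : ℂ) two_ne_zero) ^ κ i := by
    intro κ
    change ∏ j : Fin n, _ = _
    rw [Finset.prod_eq_single i]
    · simp
    · intro j _ hj
      simp [Pi.mulSingle_eq_of_ne hj]
    · simp
  rw [key, key] at h2
  have h3 := congrArg (fun z : ℂˣ => ‖(z : ℂ)‖) h2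
  simp only [Units.val_zpow_eq_zpow_val, Units.val_mk0, norm_zpow, Complex.norm_ofNat] at h3
  exact zpow_right_injective₀ (by norm_num) (by norm_num) h3

theorem expChar_eq_of_forall {μ ν : CharGroup n}
    (h : ∀ t : Torus n, (expChar μ t : ℂ) = expChar ν t) : μ = ν :=
  expChar_injective (MonoidHom.ext fun t => Units.ext (h t))

/-- Dedekind independence of characters, applied after composing with each linear functional on `M`.
-/
theorem eq_zero_of_sum_expChar (c : CharGroup n →₀ M)
    (h : ∀ t : Torus n, (c.sum fun μ m => (expChar μ t : ℂ) • m) = 0) : c = 0 := by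
  ext μ
  refine (Module.forall_dual_apply_eq_zero_iff ℂ _).1 fun ξ => ?_
  have hli : LinearIndependent ℂ fun (μ : CharGroup n) (t : Torus n) => (expChar μ t : ℂ) := by
    refine (linearIndependent_monoidHom (Torus n) ℂ).comp
      (fun μ => (Units.coeHom ℂ).comp (expChar μ)) fun μ ν h => ?_
    exact expChar_eq_of_forall fun t => DFunLike.congr_fun h t
  by_cases hμ : μ ∈ c.support
  · refine linearIndependent_iff'.1 hli c.support (fun μ => ξ (c μ)) ?_ μ hμ
    funext t
    have := congrArg ξ (h t)
    simpa [Finsupp.sum, mul_comm] using this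
  · rw [Finsupp.notMem_support_iff.1 hμ, map_zero]

variable {τ : Representation ℂ (Torus n) M} {τ' : Representation ℂ (Torus n) M'}
  {τ'' : Representation ℂ (Torus n) M''}

/-- The weight components of a vector of a rational representation. -/
def weightComponents (hτ : IsRational τ) (m : M) : CharGroup n →₀ M := (hτ m).choose

theorem weightComponents_spec (hτ : IsRational τ) (m : M) (t : Torus n) :
    τ t m = (weightComponents hτ m).sum fun μ m => (expChar μ t : ℂ) • m :=
  (hτ m).choose_spec t

/-- Independence of characters makes the chosen Laurent expansion unique; linearity of `weightProj`
and its values on weight vectors follow from this. -/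
theorem weightComponents_eq (hτ : IsRational τ) {m : M} {c : CharGroup n →₀ M}
    (h : ∀ t, τ t m = c.sum fun μ m => (expChar μ t : ℂ) • m) : weightComponents hτ m = c := by
  refine sub_eq_zero.1 (eq_zero_of_sum_expChar _ fun t => ?_)
  rw [Finsupp.sum_sub_index (by simp [smul_sub]), ← h, ← weightComponents_spec, sub_self]

/-- The projection onto a weight space of a rational representation. -/
def weightProj (hτ : IsRational τ) (μ : CharGroup n) : M →ₗ[ℂ] M where
  toFun m := weightComponents hτ m μ
  map_add' x y := by
    rw [weightComponents_eq hτ (c := weightComponents hτ x + weightComponents hτ y),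
      Finsupp.add_apply]
    intro t
    classical
    rw [Finsupp.sum_add_index' (by simp) (by simp [smul_add]), map_add,
      ← weightComponents_spec, ← weightComponents_spec]
  map_smul' r x := by
    rw [weightComponents_eq hτ (c := r • weightComponents hτ x), Finsupp.smul_apply,
      RingHom.id_apply]
    intro t
    rw [Finsupp.sum_smul_index' (by simp), map_smul, weightComponents_spec hτ, Finsupp.smul_sum]
    simp only [smul_comm r]

/-- Compare coefficients of `expChar μ t` in the two expansions of `τ s (τ t m) = τ (t * s) m`. -/
theorem weightProj_mem (hτ : IsRational τ) (μ : CharGroup n) (m : M) :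
    weightProj hτ μ m ∈ weightSpace τ μ := by
  intro s
  have h := eq_zero_of_sum_expChar (Finsupp.onFinset (weightComponents hτ m).support
    (fun μ => τ s (weightComponents hτ m μ) - (expChar μ s : ℂ) • weightComponents hτ m μ)
    fun μ hμ => by
      contrapose! hμ
      rw [Finsupp.notMem_support_iff.1 hμ, map_zero, smul_zero, sub_zero]) fun t => by
    rw [Finsupp.onFinset_sum _ fun μ => smul_zero _]
    have h1 : τ s (τ t m) = τ (t * s) m := by rw [mul_comm, map_mul]; rfl
    rw [weightComponents_spec hτ m t, weightComponents_spec hτ m (t * s)] at h1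
    simp only [Finsupp.sum, map_sum, map_smul] at h1
    simp only [smul_sub, Finset.sum_sub_distrib, h1, map_mul, Units.val_mul, mul_smul, sub_self]
  exact sub_eq_zero.1 (DFunLike.congr_fun h μ)

theorem sum_weightProj (hτ : IsRational τ) (m : M) :
    ∑ μ ∈ (weightComponents hτ m).support, weightProj hτ μ m = m := by
  have := weightComponents_spec hτ m 1
  rw [map_one] at this
  simp only [Finsupp.sum, map_one, Units.val_one, one_smul] at this
  exact this.symm

theorem weightProj_of_mem (hτ : IsRational τ) {μ : CharGroup n} {m : M}
    (hm : m ∈ weightSpace τ μ) : weightProj hτ μ m = m := by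
  change weightComponents hτ m μ = m
  rw [weightComponents_eq hτ (c := Finsupp.single μ m) fun t => ?_, Finsupp.single_eq_same]
  simp [hm t]

theorem weightProj_of_mem_ne (hτ : IsRational τ) {μ ν : CharGroup n} {m : M}
    (hm : m ∈ weightSpace τ μ) (h : μ ≠ ν) : weightProj hτ ν m = 0 := by
  classical
  change weightComponents hτ m ν = 0
  rw [weightComponents_eq hτ (c := Finsupp.single μ m) fun t => ?_, Finsupp.single_apply, if_neg h]
  simp [hm t]

theorem IsRational.induction_on (hτ : IsRational τ) {p : M → Prop} (m : M)
    (zero : p 0) (add : ∀ x y, p x → p y → p (x + y))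
    (mem : ∀ μ, ∀ x ∈ weightSpace τ μ, p x) : p m := by
  rw [← sum_weightProj hτ m]
  exact Finset.sum_induction _ p add zero fun μ _ => mem μ _ (weightProj_mem hτ μ m)

theorem IsRational.eq_bot (hτ : IsRational τ) (h : ∀ μ, weightSpace τ μ = ⊥) (m : M) : m = 0 := by
  induction m using hτ.induction_on with
  | zero => rfl
  | add x y hx hy => rw [hx, hy, add_zero]
  | mem μ x hx => rwa [h, Submodule.mem_bot] at hx

/-- A linear map which is equivariant up to the character `e^ν`. -/
def ShiftEquivariant (τ : Representation ℂ (Torus n) M) (τ' : Representation ℂ (Torus n) M')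
    (ν : CharGroup n) (f : M →ₗ[ℂ] M') : Prop :=
  ∀ t m, τ' t (f m) = (expChar ν t : ℂ) • f (τ t m)

theorem ShiftEquivariant.of_equivariant {f : M →ₗ[ℂ] M'} (h : ∀ t m, f (τ t m) = τ' t (f m)) :
    ShiftEquivariant τ τ' 0 f := fun t m => by simp [expChar_zero, h]

theorem ShiftEquivariant.map_mem {ν : CharGroup n} {f : M →ₗ[ℂ] M'}
    (hf : ShiftEquivariant τ τ' ν f) {μ : CharGroup n} {m : M} (hm : m ∈ weightSpace τ (μ - ν)) :
    f m ∈ weightSpace τ' μ := by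
  intro t
  rw [hf, hm t, map_smul, smul_smul, ← Units.val_mul, ← expChar_add, add_sub_cancel]

theorem ShiftEquivariant.weightProj_map {ν : CharGroup n} {f : M →ₗ[ℂ] M'}
    (hf : ShiftEquivariant τ τ' ν f) (hτ : IsRational τ) (hτ' : IsRational τ') (μ : CharGroup n)
    (m : M) : weightProj hτ' μ (f m) = f (weightProj hτ (μ - ν) m) := by
  induction m using hτ.induction_on with
  | zero => simp
  | add x y hx hy => simp only [map_add, hx, hy]
  | mem κ x hx =>
    have h1 : f x ∈ weightSpace τ' (κ + ν) := hf.map_mem (by rwa [add_sub_cancel_right])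
    by_cases h : κ = μ - ν
    · subst h
      rw [sub_add_cancel] at h1
      rw [weightProj_of_mem hτ hx, weightProj_of_mem hτ' h1]
    · rw [weightProj_of_mem_ne hτ hx h, weightProj_of_mem_ne hτ' h1, map_zero]
      rintro rfl
      simp at h

theorem ShiftEquivariant.mem_of_map_mem {ν : CharGroup n} {f : M →ₗ[ℂ] M'}
    (hf : ShiftEquivariant τ τ' ν f) (hinj : Function.Injective f) {μ : CharGroup n} {m : M}
    (hm : f m ∈ weightSpace τ' μ) : m ∈ weightSpace τ (μ - ν) := by
  intro t
  apply hinj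
  have h := hm t
  rw [hf] at h
  have h2 : f (τ t m) = ((expChar (-ν) t : ℂ) * (expChar ν t : ℂ)) • f (τ t m) := by
    rw [← Units.val_mul, ← expChar_add, neg_add_cancel, expChar_zero, Units.val_one, one_smul]
  rw [h2, mul_smul, h, smul_smul, map_smul, ← Units.val_mul, ← expChar_add, neg_add_eq_sub]

/-- Weight space dimensions are additive on short exact sequences. -/
theorem finrank_weightSpace_of_exact {ν : CharGroup n} {f : M' →ₗ[ℂ] M} {g : M →ₗ[ℂ] M''}
    (hτ : IsRational τ) (hτ'' : IsRational τ'')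
    (hf : ShiftEquivariant τ' τ ν f) (hg : ShiftEquivariant τ τ'' 0 g)
    (hinj : Function.Injective f) (hex : ∀ m, g m = 0 → ∃ m', f m' = m)
    (hz : ∀ m', g (f m') = 0) (hsurj : Function.Surjective g) (μ : CharGroup n)
    [FiniteDimensional ℂ (weightSpace τ μ)] :
    Module.finrank ℂ (weightSpace τ μ) =
      Module.finrank ℂ (weightSpace τ' (μ - ν)) + Module.finrank ℂ (weightSpace τ'' μ) := by
  let f' : weightSpace τ' (μ - ν) →ₗ[ℂ] weightSpace τ μ := f.restrict fun m hm => hf.map_mem hm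
  let g' : weightSpace τ μ →ₗ[ℂ] weightSpace τ'' μ :=
    g.restrict fun m hm => hg.map_mem (by rwa [sub_zero])
  have hf' : Function.Injective f' := fun a b h => Subtype.ext (hinj (congrArg Subtype.val h))
  have hg' : Function.Surjective g' := by
    rintro ⟨y, hy⟩
    obtain ⟨m, rfl⟩ := hsurj y
    refine ⟨⟨weightProj hτ μ m, weightProj_mem hτ μ m⟩, Subtype.ext ?_⟩
    change g (weightProj hτ μ m) = g m
    have := hg.weightProj_map hτ hτ'' μ m
    rw [sub_zero] at this
    rw [← this, weightProj_of_mem hτ'' hy]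
  have hk : LinearMap.ker g' = LinearMap.range f' := by
    ext ⟨m, hm⟩
    constructor
    · intro h
      obtain ⟨m', rfl⟩ := hex m (congrArg Subtype.val h)
      exact ⟨⟨m', hf.mem_of_map_mem hinj hm⟩, rfl⟩
    · rintro ⟨m', h⟩
      rw [← h]
      exact Subtype.ext (hz m')
  rw [← LinearMap.finrank_range_add_finrank_ker g', LinearMap.range_eq_top.2 hg', finrank_top, hk,
    LinearMap.finrank_range_of_inj hf', add_comm]

/-- Weight space dimensions in four-term exact sequences. -/
theorem finrank_weightSpace_of_exact₄ {K : Type*} [AddCommGroup K] [Module ℂ K]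
    {κ : Representation ℂ (Torus n) K} {ν : CharGroup n} {i : K →ₗ[ℂ] M'} {f : M' →ₗ[ℂ] M}
    {g : M →ₗ[ℂ] M''} (hτ' : IsRational τ') (hτ : IsRational τ) (hτ'' : IsRational τ'')
    (hi : ShiftEquivariant κ τ' 0 i)
    (hf : ShiftEquivariant τ' τ ν f) (hg : ShiftEquivariant τ τ'' 0 g)
    (hinj : Function.Injective i) (hif : ∀ m, f m = 0 ↔ ∃ k, i k = m)
    (hfg : ∀ m, g m = 0 ↔ ∃ m', f m' = m) (hsurj : Function.Surjective g) (μ : CharGroup n)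
    [FiniteDimensional ℂ (weightSpace τ μ)] [FiniteDimensional ℂ (weightSpace τ' (μ - ν))] :
    Module.finrank ℂ (weightSpace τ μ) + Module.finrank ℂ (weightSpace κ (μ - ν)) =
      Module.finrank ℂ (weightSpace τ' (μ - ν)) + Module.finrank ℂ (weightSpace τ'' μ) := by
  let i' : weightSpace κ (μ - ν) →ₗ[ℂ] weightSpace τ' (μ - ν) :=
    i.restrict fun m hm => hi.map_mem (by rwa [sub_zero])
  let f' : weightSpace τ' (μ - ν) →ₗ[ℂ] weightSpace τ μ := f.restrict fun m hm => hf.map_mem hm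
  let g' : weightSpace τ μ →ₗ[ℂ] weightSpace τ'' μ :=
    g.restrict fun m hm => hg.map_mem (by rwa [sub_zero])
  have hi' : Function.Injective i' := fun a b h => Subtype.ext (hinj (congrArg Subtype.val h))
  have hg' : Function.Surjective g' := by
    rintro ⟨y, hy⟩
    obtain ⟨m, rfl⟩ := hsurj y
    refine ⟨⟨weightProj hτ μ m, weightProj_mem hτ μ m⟩, Subtype.ext ?_⟩
    change g (weightProj hτ μ m) = g m
    have := hg.weightProj_map hτ hτ'' μ m
    rw [sub_zero] at this
    rw [← this, weightProj_of_mem hτ'' hy]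
  have hk : LinearMap.ker g' = LinearMap.range f' := by
    ext ⟨m, hm⟩
    constructor
    · intro h
      obtain ⟨m', rfl⟩ := (hfg m).1 (congrArg Subtype.val h)
      -- Since `f` need not be injective, the preimage may fail to be a weight vector and is
      -- replaced by its component of weight μ - ν.
      refine ⟨⟨weightProj hτ' (μ - ν) m', weightProj_mem hτ' _ m'⟩, Subtype.ext ?_⟩
      change f (weightProj hτ' (μ - ν) m') = f m'
      rw [← hf.weightProj_map hτ' hτ μ m', weightProj_of_mem hτ hm]
    · rintro ⟨m', h⟩
      rw [← h]
      exact Subtype.ext ((hfg _).2 ⟨_, rfl⟩)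
  have hk' : LinearMap.ker f' = LinearMap.range i' := by
    ext ⟨m, hm⟩
    constructor
    · intro h
      obtain ⟨m', rfl⟩ := (hif m).1 (congrArg Subtype.val h)
      have h1 := hi.mem_of_map_mem hinj hm
      rw [sub_zero] at h1
      exact ⟨⟨m', h1⟩, rfl⟩
    · rintro ⟨m', h⟩
      rw [← h]
      exact Subtype.ext ((hif _).2 ⟨_, rfl⟩)
  have h1 := LinearMap.finrank_range_add_finrank_ker g'
  have h2 := LinearMap.finrank_range_add_finrank_ker f'
  rw [LinearMap.range_eq_top.2 hg', finrank_top, hk] at h1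
  rw [hk', LinearMap.finrank_range_of_inj hi'] at h2
  omega

/-! ### Representations spanned by weight vectors -/

theorem isRational_of_span {κ : Type*} {v : κ → M} {w : κ → CharGroup n}
    (hv : ∀ k, v k ∈ weightSpace τ (w k)) (hspan : ∀ m, m ∈ Submodule.span ℂ (Set.range v)) :
    IsRational τ := by
  intro m
  induction hspan m using Submodule.span_induction with
  | mem x hx =>
    obtain ⟨k, rfl⟩ := hx
    simp only [hv k _]
    exact IsLaurent.single _ _
  | zero => simpa using IsLaurent.zero
  | add x y _ _ hx hy => simpa only [map_add] using hx.add hy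
  | smul a x _ hx => simpa using hx.map (LinearMap.lsmul ℂ M a)

/-- Projecting a combination of weight vectors to weight μ keeps exactly the terms of weight μ. -/
theorem mem_span_of_mem_weightSpace (hτ : IsRational τ) {κ : Type*} {v : κ → M}
    {w : κ → CharGroup n} (hv : ∀ k, v k ∈ weightSpace τ (w k)) {m : M}
    (hm : m ∈ Submodule.span ℂ (Set.range v)) {μ : CharGroup n} (hμ : m ∈ weightSpace τ μ) :
    m ∈ Submodule.span ℂ (v '' {k | w k = μ}) := by
  rw [← weightProj_of_mem hτ hμ]
  clear hμ
  induction hm using Submodule.span_induction with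
  | mem x hx =>
    obtain ⟨k, rfl⟩ := hx
    by_cases h : w k = μ
    · rw [weightProj_of_mem hτ (h ▸ hv k)]
      exact Submodule.subset_span ⟨k, h, rfl⟩
    · rw [weightProj_of_mem_ne hτ (hv k) h]
      exact zero_mem _
  | zero => simp
  | add x y _ _ hx hy => rw [map_add]; exact add_mem hx hy
  | smul a x _ hx => rw [map_smul]; exact Submodule.smul_mem _ _ hx

/-- The main device for locating weights: a weight that occurs in a span of weight vectors is
already the weight of one of the nonzero generators. -/
theorem exists_of_mem_weightSpace (hτ : IsRational τ) {κ : Type*} {v : κ → M}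
    {w : κ → CharGroup n} (hv : ∀ k, v k ∈ weightSpace τ (w k)) {m : M}
    (hm : m ∈ Submodule.span ℂ (Set.range v)) {μ : CharGroup n} (hμ : m ∈ weightSpace τ μ)
    (h0 : m ≠ 0) : ∃ k, w k = μ ∧ v k ≠ 0 := by
  by_contra! h
  apply h0
  have h1 := mem_span_of_mem_weightSpace hτ hv hm hμ
  have h2 : Submodule.span ℂ (v '' {k | w k = μ}) ≤ ⊥ := by
    rw [Submodule.span_le]
    rintro _ ⟨k, hk, rfl⟩
    exact h k hk
  exact h2 h1

end WeightTheory

/-! ### Operations on Laurent functions and stable subspaces -/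

section RationalOps

variable {n : ℕ} {M : Type*} [AddCommGroup M] [Module ℂ M]

theorem IsLaurent.expChar_smul {φ : Torus n → M} (h : IsLaurent φ) (μ : CharGroup n) :
    IsLaurent fun t => (expChar μ t : ℂ) • φ t := by
  obtain ⟨c, hc⟩ := h
  simp only [hc, Finsupp.sum, Finset.smul_sum, smul_smul, ← Units.val_mul, ← expChar_add]
  exact IsLaurent.sum _ fun ν _ => IsLaurent.single _ _

theorem IsLaurent.pi {ι : Type*} [Fintype ι] {φ : Torus n → ι → M}
    (h : ∀ i, IsLaurent fun t => φ t i) : IsLaurent φ := by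
  classical
  have : φ = fun t => ∑ i, LinearMap.single ℂ (fun _ => M) i (φ t i) := by
    funext t
    exact (LinearMap.sum_single_apply _ (φ t)).symm
  rw [this]
  exact IsLaurent.sum _ fun i _ => (h i).map _

variable {τ : Representation ℂ (Torus n) M}

/-- Weight projections commute with the equivariant quotient map `M → M ⧸ N`, so they preserve its
kernel. -/
theorem weightProj_mem_of_stable (hτ : IsRational τ) {N : Submodule ℂ M}
    (hN : ∀ t, N ≤ N.comap (τ t)) (μ : CharGroup n) {m : M} (hm : m ∈ N) :
    weightProj hτ μ m ∈ N := by
  have hq : IsRational (τ.quotient N hN) := by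
    intro y
    obtain ⟨x, rfl⟩ := N.mkQ_surjective y
    exact (hτ x).map N.mkQ
  have h : ShiftEquivariant τ (τ.quotient N hN) 0 N.mkQ :=
    ShiftEquivariant.of_equivariant fun t m => rfl
  have h2 := h.weightProj_map hτ hq μ m
  rw [sub_zero, (Submodule.Quotient.mk_eq_zero N).2 hm |> (show N.mkQ m = 0 from ·),
    map_zero] at h2
  exact (Submodule.Quotient.mk_eq_zero N).1 h2.symm

end RationalOps

/-! ### Coordinate functions and monomials on V -/

section Coordinates

variable {n : ℕ} {V : Type u} [AddCommGroup V] [Module ℂ V]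

/-- Keeps equivariant submodules finitely generated, so that kernels and syzygies are again
coherent. -/
instance [FiniteDimensional ℂ V] : IsNoetherianRing (CoordRing V) :=
  isNoetherianRing_of_ringEquiv _
    (SymmetricAlgebra.equivMvPolynomial (Module.finBasis ℂ (Module.Dual ℂ V))).symm.toRingEquiv

variable {d : ℕ} (b : Module.Basis (Fin d) ℂ V)

/-- The coordinate functions on `V` with respect to a basis. -/
def coordX (i : Fin d) : CoordRing V := SymmetricAlgebra.ι ℂ _ (b.coord i)

/-- Monomials in the coordinate functions. -/
def coordMonomial (a : Fin d → ℕ) : CoordRing V := ∏ i, coordX b i ^ a i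

/-- The coordinate ring is a polynomial ring in the coordinate functions. -/
def coordEquiv : CoordRing V ≃ₐ[ℂ] MvPolynomial (Fin d) ℂ :=
  SymmetricAlgebra.equivMvPolynomial b.dualBasis

theorem coordEquiv_coordX (i : Fin d) : coordEquiv b (coordX b i) = MvPolynomial.X i := by
  rw [coordX, ← Module.Basis.coe_dualBasis]
  exact SymmetricAlgebra.equivMvPolynomial_ι_apply _ _

theorem span_coordMonomial : Submodule.span ℂ (Set.range (coordMonomial b)) = ⊤ := by
  rw [eq_top_iff]
  intro f _
  have key : ∀ p : MvPolynomial (Fin d) ℂ,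
      (coordEquiv b).symm p ∈ Submodule.span ℂ (Set.range (coordMonomial b)) := by
    intro p
    induction p using MvPolynomial.induction_on' with
    | monomial a r =>
      have : (coordEquiv b).symm (MvPolynomial.monomial a r) = r • coordMonomial b a := by
        rw [AlgEquiv.symm_apply_eq, map_smul, coordMonomial, map_prod]
        simp only [map_pow, coordEquiv_coordX]
        rw [MvPolynomial.monomial_eq, Finsupp.prod_fintype _ _ (by simp), MvPolynomial.smul_eq_C_mul]
      rw [this]
      exact Submodule.smul_mem _ _ (Submodule.subset_span ⟨a, rfl⟩)
    | add p q hp hq => rw [map_add]; exact add_mem hp hq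
  simpa using key (coordEquiv b f)

theorem originIdeal_eq_span : originIdeal V = Ideal.span (Set.range (coordX b)) := by
  apply le_antisymm
  · intro f hf
    -- Subtracting the constant term makes the claim meaningful for all functions, which allows
    -- induction on the symmetric algebra.
    have key : ∀ g : CoordRing V,
        g - algebraMap ℂ _ (evalZero V g) ∈ Ideal.span (Set.range (coordX b)) := by
      intro g
      induction g using SymmetricAlgebra.induction with
      | algebraMap r => simp
      | ι ξ =>
        rw [evalZero_ι, map_zero, sub_zero, ← b.sum_dual_apply_smul_coord ξ, map_sum]
        refine sum_mem fun i _ => ?_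
        rw [map_smul, Algebra.smul_def]
        exact Ideal.mul_mem_left _ _ (Ideal.subset_span ⟨i, rfl⟩)
      | mul p q hp hq =>
        have : p * q - algebraMap ℂ _ (evalZero V (p * q)) =
            (p - algebraMap ℂ _ (evalZero V p)) * q +
            algebraMap ℂ _ (evalZero V p) * (q - algebraMap ℂ _ (evalZero V q)) := by
          rw [map_mul, map_mul]; ring
        rw [this]
        exact add_mem (Ideal.mul_mem_right _ _ hp) (Ideal.mul_mem_left _ _ hq)
      | add p q hp hq =>
        rw [map_add, map_add, add_sub_add_comm]
        exact add_mem hp hq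
    have h0 : evalZero V f = 0 := hf
    simpa [h0] using key f
  · rw [Ideal.span_le]
    rintro _ ⟨i, rfl⟩
    exact evalZero_ι _

variable {ρ : Representation ℂ (Torus n) V} {β : Fin d → CharGroup n}

theorem dual_coord (hb : ∀ i, b i ∈ weightSpace ρ (β i)) (i : Fin d) (t : Torus n) :
    ρ.dual t (b.coord i) = (expChar (-β i) t : ℂ) • b.coord i := by
  refine b.ext fun j => ?_
  rw [Representation.dual_apply, Module.Dual.transpose_apply, LinearMap.comp_apply, hb j t⁻¹,
    map_smul, LinearMap.smul_apply, expChar_neg_inv, Module.Basis.coord_apply,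
    Module.Basis.repr_self]
  by_cases h : j = i
  · rw [h]
  · simp [h]

theorem coordX_mem (hb : ∀ i, b i ∈ weightSpace ρ (β i)) (i : Fin d) :
    coordX b i ∈ weightSpace (algRep (coordAct ρ)) (-β i) := by
  intro t
  change coordAct ρ t (coordX b i) = _
  rw [coordX, coordAct_ι, dual_coord b hb, map_smul]

theorem mul_mem_weightSpace {A : Type*} [CommRing A] [Algebra ℂ A] {σ : Torus n →* (A →ₐ[ℂ] A)}
    {μ ν : CharGroup n} {f g : A} (hf : f ∈ weightSpace (algRep σ) μ)
    (hg : g ∈ weightSpace (algRep σ) ν) : f * g ∈ weightSpace (algRep σ) (μ + ν) := by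
  intro t
  have h1 : σ t f = _ := hf t
  have h2 : σ t g = _ := hg t
  change σ t (f * g) = _
  rw [map_mul, h1, h2, smul_mul_smul_comm, expChar_add, Units.val_mul]

theorem one_mem_weightSpace {A : Type*} [CommRing A] [Algebra ℂ A] {σ : Torus n →* (A →ₐ[ℂ] A)} :
    (1 : A) ∈ weightSpace (algRep σ) 0 := by
  intro t
  change σ t 1 = _
  rw [map_one, expChar_zero, Units.val_one, one_smul]

theorem pow_mem_weightSpace {A : Type*} [CommRing A] [Algebra ℂ A] {σ : Torus n →* (A →ₐ[ℂ] A)}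
    {μ : CharGroup n} {f : A} (hf : f ∈ weightSpace (algRep σ) μ) (k : ℕ) :
    f ^ k ∈ weightSpace (algRep σ) (k • μ) := by
  induction k with
  | zero => simpa using one_mem_weightSpace
  | succ k ih =>
    rw [pow_succ, succ_nsmul]
    exact mul_mem_weightSpace ih hf

theorem prod_mem_weightSpace {A : Type*} [CommRing A] [Algebra ℂ A] {σ : Torus n →* (A →ₐ[ℂ] A)}
    {ι : Type*} (s : Finset ι) {μ : ι → CharGroup n} {f : ι → A}
    (hf : ∀ i, f i ∈ weightSpace (algRep σ) (μ i)) :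
    ∏ i ∈ s, f i ∈ weightSpace (algRep σ) (∑ i ∈ s, μ i) := by
  classical
  induction s using Finset.induction_on with
  | empty => simpa using one_mem_weightSpace
  | insert a s ha ih =>
    rw [Finset.prod_insert ha, Finset.sum_insert ha]
    exact mul_mem_weightSpace (hf a) ih

theorem coordMonomial_mem (hb : ∀ i, b i ∈ weightSpace ρ (β i)) (a : Fin d → ℕ) :
    coordMonomial b a ∈ weightSpace (algRep (coordAct ρ)) (∑ i, a i • -β i) :=
  prod_mem_weightSpace _ fun i => pow_mem_weightSpace (coordX_mem b hb i) (a i)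

end Coordinates

/-! ### Equivariant coherent modules: generators, weight bounds, graded Nakayama -/

namespace EquivModule

variable {n : ℕ} {V : Type u} [AddCommGroup V] [Module ℂ V] {ρ : Representation ℂ (Torus n) V}

theorem smul_mem_weightSpace (M : EquivModule ρ) {μ ν : CharGroup n} {f : CoordRing V}
    {m : M.carrier} (hf : f ∈ weightSpace (algRep (coordAct ρ)) μ) (hm : m ∈ weightSpace M.rep ν) :
    f • m ∈ weightSpace M.rep (μ + ν) := by
  intro t
  have h1 : coordAct ρ t f = _ := hf t
  rw [M.rep_smul, h1, hm t, smul_assoc, smul_comm f, smul_smul, expChar_add, Units.val_mul]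

/-- The homomorphism from a free module given by weight vectors. -/
def freeMap (M : EquivModule ρ) {k : ℕ} (m : Fin k → M.carrier) :
    (Fin k → CoordRing V) →ₗ[CoordRing V] M.carrier := Fintype.linearCombination _ m

theorem range_freeMap (M : EquivModule ρ) {k : ℕ} (m : Fin k → M.carrier) :
    LinearMap.range (M.freeMap m) = Submodule.span (CoordRing V) (Set.range m) :=
  Fintype.range_linearCombination _ m

/-- Equivariant coherent modules are generated by finitely many weight vectors. -/
theorem exists_generators (M : EquivModule ρ) :
    ∃ (k : ℕ) (m : Fin k → M.carrier) (w : Fin k → CharGroup n),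
      (∀ i, m i ∈ weightSpace M.rep (w i)) ∧
      Submodule.span (CoordRing V) (Set.range m) = ⊤ := by
  classical
  obtain ⟨s, hs⟩ := M.finite.fg_top
  let s' : Finset M.carrier := s.biUnion fun x =>
    (weightComponents M.rational x).support.image fun μ => weightProj M.rational μ x
  have hw : ∀ x : s', ∃ μ, (x : M.carrier) ∈ weightSpace M.rep μ := by
    rintro ⟨x, hx⟩
    obtain ⟨y, _, hy⟩ := Finset.mem_biUnion.1 hx
    obtain ⟨μ, _, rfl⟩ := Finset.mem_image.1 hy
    exact ⟨μ, weightProj_mem _ _ _⟩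
  choose w hw using hw
  let e := s'.equivFin.symm
  refine ⟨s'.card, fun i => e i, fun i => w (e i), fun i => hw _, ?_⟩
  have hr : Set.range (fun i => (e i : M.carrier)) = s' := by
    ext x
    constructor
    · rintro ⟨i, rfl⟩
      exact (e i).2
    · intro hx
      exact ⟨e.symm ⟨x, hx⟩, by simp⟩
  rw [hr, eq_top_iff, ← hs, Submodule.span_le]
  intro x hx
  change x ∈ Submodule.span (CoordRing V) (s' : Set M.carrier)
  rw [← sum_weightProj M.rational x]
  exact sum_mem fun μ hμ => Submodule.subset_span
    (Finset.mem_biUnion.2 ⟨x, hx, Finset.mem_image.2 ⟨μ, hμ, rfl⟩⟩)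

variable [FiniteDimensional ℂ V]

/-- An equivariant submodule. -/
def sub (M : EquivModule ρ) (N : Submodule (CoordRing V) M.carrier)
    (hN : ∀ t, ∀ m ∈ N, M.rep t m ∈ N) : EquivModule ρ where
  carrier := N
  rep :=
    { toFun t :=
        { toFun m := ⟨M.rep t m, hN t m m.2⟩
          map_add' x y := Subtype.ext (map_add _ _ _)
          map_smul' r x := Subtype.ext (map_smul (M.rep t) r (x : M.carrier)) }
      map_one' := LinearMap.ext fun x => Subtype.ext <| by
        change M.rep 1 (x : M.carrier) = x
        rw [map_one]; rfl
      map_mul' s t := LinearMap.ext fun x => Subtype.ext <| by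
        change M.rep (s * t) (x : M.carrier) = M.rep s (M.rep t x)
        rw [map_mul]; rfl }
  rep_smul t f m := Subtype.ext (M.rep_smul t f m)
  rational := by
    intro m
    have hp : ∀ μ, weightProj M.rational μ (m : M.carrier) ∈ N := fun μ =>
      weightProj_mem_of_stable M.rational (N := N.restrictScalars ℂ) (fun t x hx => hN t x hx) μ m.2
    refine ⟨Finsupp.onFinset (weightComponents M.rational (m : M.carrier)).support
      (fun μ => ⟨_, hp μ⟩) fun μ hμ => ?_, fun t => ?_⟩
    · rw [Finsupp.mem_support_iff]
      intro h
      exact hμ (Subtype.ext h)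
    · rw [Finsupp.onFinset_sum _ fun μ => smul_zero _]
      apply Subtype.ext
      rw [AddSubmonoidClass.coe_finsetSum]
      exact weightComponents_spec M.rational (m : M.carrier) t

/-- The quotient by an equivariant submodule. -/
def quot (M : EquivModule ρ) (N : Submodule (CoordRing V) M.carrier)
    (hN : ∀ t, ∀ m ∈ N, M.rep t m ∈ N) : EquivModule ρ where
  carrier := M.carrier ⧸ N
  isScalarTower := ⟨fun r f m => by
    obtain ⟨m, rfl⟩ := N.mkQ_surjective m
    exact congrArg N.mkQ (smul_assoc r f m)⟩
  rep := M.rep.quotient (N.restrictScalars ℂ) (fun t x hx => hN t x hx)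
  rep_smul t f m := by
    obtain ⟨m, rfl⟩ := N.mkQ_surjective m
    exact congrArg N.mkQ (M.rep_smul t f m)
  rational := by
    intro m
    obtain ⟨m, rfl⟩ := N.mkQ_surjective m
    exact (M.rational m).map (N.restrictScalars ℂ).mkQ

theorem isShortExact_sub_quot (M : EquivModule ρ) (N : Submodule (CoordRing V) M.carrier)
    (hN : ∀ t, ∀ m ∈ N, M.rep t m ∈ N) : IsShortExact (M.sub N hN) M (M.quot N hN) :=
  ⟨N.subtype, (N.mkQ : M.carrier →ₗ[CoordRing V] M.carrier ⧸ N), fun _ _ => rfl, fun _ _ => rfl,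
    N.injective_subtype, LinearMap.exact_subtype_mkQ N, N.mkQ_surjective⟩

/-- The free module with basis vectors of given weights. -/
def free (hρ : IsRational ρ) {k : ℕ} (w : Fin k → CharGroup n) : EquivModule ρ where
  carrier := Fin k → CoordRing V
  rep :=
    { toFun t :=
        { toFun f i := (expChar (w i) t : ℂ) • coordAct ρ t (f i)
          map_add' f g := by funext i; simp
          map_smul' r f := by funext i; simp [smul_comm r] }
      map_one' := LinearMap.ext fun f => by funext i; simp
      map_mul' s t := LinearMap.ext fun f => by
        funext i
        change (expChar (w i) (s * t) : ℂ) • coordAct ρ (s * t) (f i) =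
          (expChar (w i) s : ℂ) • coordAct ρ s ((expChar (w i) t : ℂ) • coordAct ρ t (f i))
        rw [map_mul, map_mul, map_smul, smul_smul, Units.val_mul]
        rfl }
  rep_smul t f m := by
    funext i
    change (expChar (w i) t : ℂ) • coordAct ρ t (f * m i) =
      coordAct ρ t f * ((expChar (w i) t : ℂ) • coordAct ρ t (m i))
    rw [map_mul, mul_smul_comm]
  rational m := IsLaurent.pi fun i => (isRational_coord hρ (m i)).expChar_smul (w i)

theorem freeMap_rep (hρ : IsRational ρ) (M : EquivModule ρ) {k : ℕ} {m : Fin k → M.carrier}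
    {w : Fin k → CharGroup n} (hm : ∀ i, m i ∈ weightSpace M.rep (w i)) (t : Torus n)
    (f : Fin k → CoordRing V) :
    M.freeMap m ((free hρ w).rep t f) = M.rep t (M.freeMap m f) := by
  change ∑ i, ((expChar (w i) t : ℂ) • coordAct ρ t (f i)) • m i = M.rep t (∑ i, f i • m i)
  rw [map_sum]
  refine Finset.sum_congr rfl fun i _ => ?_
  rw [M.rep_smul, hm i t, smul_comm]
  exact smul_assoc (expChar (w i) t : ℂ) (coordAct ρ t (f i)) (m i)

variable {d : ℕ} {b : Module.Basis (Fin d) ℂ V} {β : Fin d → CharGroup n}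

omit [FiniteDimensional ℂ V] in
open scoped Pointwise in
theorem span_monomial_smul (b : Module.Basis (Fin d) ℂ V) (M : EquivModule ρ) {k : ℕ}
    {m : Fin k → M.carrier} (hspan : Submodule.span (CoordRing V) (Set.range m) = ⊤)
    (x : M.carrier) :
    x ∈ Submodule.span ℂ (Set.range fun p : (Fin d → ℕ) × Fin k => coordMonomial b p.1 • m p.2) := by
  have h := Submodule.span_smul_of_span_eq_top (span_coordMonomial b) (Set.range m)
  rw [hspan, Submodule.restrictScalars_top] at h
  have h2 : x ∈ Submodule.span ℂ (Set.range (coordMonomial b) • Set.range m) := by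
    rw [h]; trivial
  refine Submodule.span_mono ?_ h2
  rintro _ ⟨_, ⟨a, rfl⟩, _, ⟨j, rfl⟩, rfl⟩
  exact ⟨(a, j), rfl⟩

omit [FiniteDimensional ℂ V] in
theorem monomial_smul_mem (hb : ∀ i, b i ∈ weightSpace ρ (β i)) (M : EquivModule ρ) {k : ℕ}
    {m : Fin k → M.carrier} {w : Fin k → CharGroup n}
    (hm : ∀ i, m i ∈ weightSpace M.rep (w i)) (p : (Fin d → ℕ) × Fin k) :
    coordMonomial b p.1 • m p.2 ∈ weightSpace M.rep (∑ i, p.1 i • -β i + w p.2) :=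
  M.smul_mem_weightSpace (coordMonomial_mem b hb _) (hm _)

variable {ℓ : CharGroup n →+ ℝ}

theorem map_monomial_weight (ℓ : CharGroup n →+ ℝ) (β : Fin d → CharGroup n) (a : Fin d → ℕ)
    (ν : CharGroup n) : ℓ (∑ i, a i • -β i + ν) = ℓ ν - ∑ i, (a i : ℝ) * ℓ (β i) := by
  rw [map_add, map_sum]
  simp only [map_nsmul, map_neg]
  simp only [nsmul_eq_mul, mul_neg, Finset.sum_neg_distrib]
  ring

-- The half-space condition leaves only finitely many products of a monomial and a generator in each
-- weight.
omit [FiniteDimensional ℂ V] in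
theorem finiteDimensional_weightSpace (hb : ∀ i, b i ∈ weightSpace ρ (β i))
    (hℓ : ∀ i, 0 < ℓ (β i)) (M : EquivModule ρ) (μ : CharGroup n) :
    FiniteDimensional ℂ (weightSpace M.rep μ) := by
  obtain ⟨k, m, w, hm, hspan⟩ := M.exists_generators
  have hfin : {p : (Fin d → ℕ) × Fin k | ∑ i, p.1 i • -β i + w p.2 = μ}.Finite := by
    -- From ℓ μ = ℓ (w j) - ∑ a i · ℓ (β i) with nonnegative summands, each exponent is at most (ℓ
    -- (w j) - ℓ μ) / ℓ (β i).
    refine Set.Finite.subset (Set.finite_iUnion fun j : Fin k => (Set.finite_Iic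
      (fun i => ⌊(ℓ (w j) - ℓ μ) / ℓ (β i)⌋₊ : Fin d → ℕ)).image fun a => (a, j)) ?_
    rintro ⟨a, j⟩ h
    refine Set.mem_iUnion.2 ⟨j, a, fun i => Nat.le_floor ?_, rfl⟩
    rw [le_div_iff₀ (hℓ i)]
    have h1 := congrArg ℓ (show ∑ i, a i • -β i + w j = μ from h)
    rw [map_monomial_weight] at h1
    have h2 : (a i : ℝ) * ℓ (β i) ≤ ∑ i, (a i : ℝ) * ℓ (β i) :=
      Finset.single_le_sum (f := fun i => (a i : ℝ) * ℓ (β i))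
        (fun i _ => mul_nonneg (Nat.cast_nonneg _) (hℓ i).le) (Finset.mem_univ i)
    linarith
  have := FiniteDimensional.span_of_finite ℂ
    (hfin.image fun p : (Fin d → ℕ) × Fin k => coordMonomial b p.1 • m p.2)
  exact Submodule.finiteDimensional_of_le (S₂ := Submodule.span ℂ _) fun x hx =>
    mem_span_of_mem_weightSpace M.rational (monomial_smul_mem hb M hm)
      (M.span_monomial_smul b hspan x) hx

-- Multiplication by coordinates lowers ℓ, so ℓ is bounded by its values on the generators. The sum
-- of absolute values serves as a bound even when there are no generators.
omit [FiniteDimensional ℂ V] in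
theorem exists_weight_bound (hb : ∀ i, b i ∈ weightSpace ρ (β i))
    (hℓ : ∀ i, 0 < ℓ (β i)) (M : EquivModule ρ) :
    ∃ C : ℝ, ∀ μ, ∀ m ∈ weightSpace M.rep μ, m ≠ 0 → ℓ μ ≤ C := by
  obtain ⟨k, m, w, hm, hspan⟩ := M.exists_generators
  refine ⟨∑ j, |ℓ (w j)|, fun μ x hx hx0 => ?_⟩
  obtain ⟨⟨a, j⟩, rfl, -⟩ := exists_of_mem_weightSpace M.rational (monomial_smul_mem hb M hm)
    (M.span_monomial_smul b hspan x) hx hx0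
  rw [map_monomial_weight]
  have h1 : 0 ≤ ∑ i, (a i : ℝ) * ℓ (β i) :=
    Finset.sum_nonneg fun i _ => mul_nonneg (Nat.cast_nonneg _) (hℓ i).le
  have h2 : |ℓ (w j)| ≤ ∑ j, |ℓ (w j)| :=
    Finset.single_le_sum (f := fun j => |ℓ (w j)|) (fun j _ => abs_nonneg _) (Finset.mem_univ j)
  linarith [le_abs_self (ℓ (w j))]

omit [FiniteDimensional ℂ V] in
/-- Graded Nakayama lemma. -/
theorem eq_zero_of_originIdeal_smul_eq_top (hb : ∀ i, b i ∈ weightSpace ρ (β i))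
    (hℓ : ∀ i, 0 < ℓ (β i)) (M : EquivModule ρ)
    (h : originIdeal V • (⊤ : Submodule (CoordRing V) M.carrier) = ⊤) (x : M.carrier) : x = 0 := by
  let v : Fin d × (Σ μ, weightSpace M.rep μ) → M.carrier := fun p => coordX b p.1 • (p.2.2 : M.carrier)
  have hv : ∀ p, v p ∈ weightSpace M.rep (-β p.1 + p.2.1) := fun p =>
    M.smul_mem_weightSpace (coordX_mem b hb p.1) p.2.2.2
  have hX : ∀ f ∈ originIdeal V, ∀ m : M.carrier, f • m ∈ Submodule.span ℂ (Set.range v) := by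
    intro f hf
    rw [originIdeal_eq_span b] at hf
    induction hf using Submodule.span_induction with
    | mem f hf =>
      obtain ⟨i, rfl⟩ := hf
      intro m
      induction m using M.rational.induction_on with
      | zero => simp
      | add x y hx hy => rw [smul_add]; exact add_mem hx hy
      | mem μ x hx => exact Submodule.subset_span ⟨(i, ⟨μ, x, hx⟩), rfl⟩
    | zero => simp
    | add f g _ _ hf hg => intro m; rw [add_smul]; exact add_mem (hf m) (hg m)
    | smul a f _ hf => intro m; rw [smul_eq_mul, mul_comm, mul_smul]; exact hf _
  have hspan : ∀ m : M.carrier, m ∈ Submodule.span ℂ (Set.range v) := by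
    intro m
    have hm : m ∈ originIdeal V • (⊤ : Submodule (CoordRing V) M.carrier) := by rw [h]; trivial
    induction hm using Submodule.smul_induction_on' with
    | smul f hf x _ => exact hX f hf x
    | add x _ y _ hx hy => exact add_mem hx hy
  refine M.rational.eq_bot (fun μ => (Submodule.eq_bot_iff _).2 fun x hx => ?_) x
  by_contra hx0
  obtain ⟨C, hC⟩ := M.exists_weight_bound hb hℓ
  -- A uniform gain in ℓ; for d = 0 there are no coordinates and any positive number will do.
  obtain ⟨ε, hε, hle⟩ : ∃ ε > 0, ∀ i, ε ≤ ℓ (β i) := by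
    rcases isEmpty_or_nonempty (Fin d) with he | he
    · exact ⟨1, one_pos, fun i => he.elim i⟩
    · obtain ⟨i, hi⟩ := Finite.exists_min fun i => ℓ (β i)
      exact ⟨_, hℓ i, hi⟩
  -- If 𝔫M = M, a nonzero weight vector of weight ν forces some nonzero x_i • z of weight ν, and z
  -- has weight ν + β_i. Iterating climbs past the upper bound on ℓ.
  have key : ∀ k : ℕ, ∃ ν, ∃ y ∈ weightSpace M.rep ν, y ≠ 0 ∧ ℓ μ + k * ε ≤ ℓ ν := by
    intro k
    induction k with
    | zero => exact ⟨μ, x, hx, hx0, by simp⟩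
    | succ k ih =>
      obtain ⟨ν, y, hy, hy0, hν⟩ := ih
      obtain ⟨⟨i, κ, z, hz⟩, h1, h2⟩ := exists_of_mem_weightSpace M.rational hv (hspan y) hy hy0
      refine ⟨κ, z, hz, ?_, ?_⟩
      · rintro rfl
        exact h2 (smul_zero _)
      · have h3 := congrArg ℓ (show -β i + κ = ν from h1)
        rw [map_add, map_neg] at h3
        have := hle i
        push_cast
        linarith
  obtain ⟨k, hk⟩ := exists_nat_gt ((C - ℓ μ) / ε)
  obtain ⟨ν, y, hy, hy0, hν⟩ := key k
  rw [div_lt_iff₀ hε] at hk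
  linarith [hC ν y hy hy0]

end EquivModule

/-! ### Weakly regular sequences and syzygies -/

section PrefixRegular

variable {A : Type*} [CommRing A] {d : ℕ} (X : Fin d → A)

/-- The ideal generated by the first `j` members of a sequence. -/
def prefixIdeal (j : ℕ) : Ideal A := Ideal.span (X '' {k | (k : ℕ) < j})

theorem prefixIdeal_zero : prefixIdeal X 0 = ⊥ := by simp [prefixIdeal]

theorem prefixIdeal_succ (i : Fin d) :
    prefixIdeal X (i + 1) = prefixIdeal X i ⊔ Ideal.span {X i} := by
  rw [prefixIdeal, prefixIdeal, ← Ideal.span_union, ← Set.image_singleton, ← Set.image_union]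
  congr 2
  ext k
  simp only [Set.mem_ofPred_eq, Set.mem_union, Set.mem_singleton_iff, Fin.ext_iff]
  omega

theorem prefixIdeal_length : prefixIdeal X d = Ideal.span (Set.range X) := by
  rw [prefixIdeal, ← Set.image_univ]
  congr 2
  ext k
  simp

theorem mem_prefixIdeal_succ_smul {M : Type*} [AddCommGroup M] [Module A M] (i : Fin d) (m : M) :
    m ∈ prefixIdeal X (i + 1) • (⊤ : Submodule A M) ↔
      ∃ y ∈ prefixIdeal X i • (⊤ : Submodule A M), ∃ z, y + X i • z = m := by
  rw [prefixIdeal_succ, Submodule.sup_smul, Submodule.mem_sup]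
  refine exists_congr fun y => and_congr_right fun _ => ?_
  constructor
  · rintro ⟨z, hz, h⟩
    rw [Submodule.ideal_span_singleton_smul] at hz
    obtain ⟨w, -, rfl⟩ := (Submodule.mem_smul_pointwise_iff_exists _ _ _).1 hz
    exact ⟨w, h⟩
  · rintro ⟨z, h⟩
    exact ⟨_, Submodule.smul_mem_smul (Ideal.subset_span rfl) trivial, h⟩

/-- The first `j` members of the sequence form a weakly regular sequence on the module. -/
def RegularUpTo (j : ℕ) (M : Type*) [AddCommGroup M] [Module A M] : Prop :=
  ∀ i : Fin d, (i : ℕ) < j → ∀ m : M, X i • m ∈ prefixIdeal X i • (⊤ : Submodule A M) →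
    m ∈ prefixIdeal X i • (⊤ : Submodule A M)

theorem map_mem_smul_top {M N : Type*} [AddCommGroup M] [Module A M] [AddCommGroup N] [Module A N]
    (f : M →ₗ[A] N) {I : Ideal A} {m : M} (hm : m ∈ I • (⊤ : Submodule A M)) :
    f m ∈ I • (⊤ : Submodule A N) := by
  have : f m ∈ (I • (⊤ : Submodule A M)).map f := ⟨m, hm, rfl⟩
  rw [Submodule.map_smul''] at this
  exact Submodule.smul_mono le_rfl le_top this

variable {X}

/-- A projective module is a retract of a free one, where membership in I·F is checked
coordinatewise. -/
theorem RegularUpTo.of_projective {j : ℕ} (h : RegularUpTo X j A) (M : Type*) [AddCommGroup M]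
    [Module A M] [Module.Projective A M] : RegularUpTo X j M := by
  obtain ⟨s, hs⟩ := Module.projective_def'.1 (inferInstance : Module.Projective A M)
  intro i hi m hm
  have hmem : ∀ f : M →₀ A, f ∈ prefixIdeal X i • (⊤ : Submodule A (M →₀ A)) ↔
      ∀ x, f x ∈ prefixIdeal X i • (⊤ : Submodule A A) := by
    intro f
    have h1 := Finsupp.submodule_smul A M (fun _ => (⊤ : Submodule A A)) (prefixIdeal X i)
    have h2 : Finsupp.submodule (fun _ : M => (⊤ : Submodule A A)) = ⊤ := by
      ext f; simp
    rw [h2] at h1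
    rw [← h1, Finsupp.mem_submodule_iff]
  have h1 := map_mem_smul_top s hm
  rw [map_smul, hmem] at h1
  have h2 := map_mem_smul_top (Finsupp.linearCombination A id)
    ((hmem (s m)).2 fun x => h i hi _ (h1 x))
  rwa [← LinearMap.comp_apply, hs, LinearMap.id_apply] at h2

theorem RegularUpTo.smul_eq_zero_quot {j : ℕ} {M : Type*} [AddCommGroup M] [Module A M]
    (hM : RegularUpTo X j M) {i : Fin d} (hi : (i : ℕ) < j)
    (y : M ⧸ prefixIdeal X i • (⊤ : Submodule A M)) (hy : X i • y = 0) : y = 0 := by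
  obtain ⟨x, rfl⟩ := Submodule.mkQ_surjective _ y
  exact (Submodule.Quotient.mk_eq_zero _).2 (hM i hi x ((Submodule.Quotient.mk_eq_zero _).1 hy))

variable (X) in
theorem prefixIdeal_smul_le (M : Type*) [AddCommGroup M] [Module A M] (i : Fin d) :
    prefixIdeal X i • (⊤ : Submodule A M) ≤ prefixIdeal X (i + 1) • ⊤ := by
  refine Submodule.smul_mono ?_ le_rfl
  rw [prefixIdeal_succ]
  exact le_sup_left

variable (X) in
-- Identifies M/I_{i+1}M as the cokernel of X_i on M/I_iM.
theorem factor_prefixIdeal_eq_zero_iff (M : Type*) [AddCommGroup M] [Module A M] (i : Fin d)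
    (y : M ⧸ prefixIdeal X i • (⊤ : Submodule A M)) :
    Submodule.factor (prefixIdeal_smul_le X M i) y = 0 ↔ ∃ z, X i • z = y := by
  obtain ⟨x, rfl⟩ := Submodule.mkQ_surjective _ y
  change (Submodule.Quotient.mk x : M ⧸ prefixIdeal X (i + 1) • (⊤ : Submodule A M)) = 0 ↔ _
  rw [Submodule.Quotient.mk_eq_zero, mem_prefixIdeal_succ_smul, Submodule.mkQ_apply]
  constructor
  · rintro ⟨u, hu, z, rfl⟩
    refine ⟨Submodule.Quotient.mk z, ?_⟩
    rw [← Submodule.Quotient.mk_smul, Submodule.Quotient.eq, sub_add_cancel_right]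
    exact neg_mem hu
  · rintro ⟨z, hz⟩
    obtain ⟨z, rfl⟩ := Submodule.mkQ_surjective _ z
    rw [Submodule.mkQ_apply, ← Submodule.Quotient.mk_smul, Submodule.Quotient.eq] at hz
    exact ⟨_, neg_mem hz, z, by abel⟩

section Exact

variable {K F M : Type*} [AddCommGroup K] [Module A K] [AddCommGroup F] [Module A F]
  [AddCommGroup M] [Module A M] {f : K →ₗ[A] F} {g : F →ₗ[A] M}

/-- An elementary form of the vanishing of Tor₁(A/I_i, M): reducing 0 → K → F → M → 0 modulo I_i
keeps the left map injective. -/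
theorem RegularUpTo.mem_of_map_mem {j : ℕ} (hj : j ≤ d) (hM : RegularUpTo X j M)
    (hf : Function.Injective f) (hfg : Function.Exact f g) (hg : Function.Surjective g) {i : ℕ}
    (hi : i ≤ j) : ∀ k : K, f k ∈ prefixIdeal X i • (⊤ : Submodule A F) →
      k ∈ prefixIdeal X i • (⊤ : Submodule A K) := by
  induction i with
  | zero =>
    intro k hk
    rw [prefixIdeal_zero, Submodule.bot_smul, Submodule.mem_bot] at hk ⊢
    exact hf (hk.trans (map_zero f).symm)
  | succ i ih =>
    intro k hk
    specialize ih (by omega)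
    obtain ⟨i, rfl⟩ : ∃ i' : Fin d, (i' : ℕ) = i := ⟨⟨i, by omega⟩, rfl⟩
    obtain ⟨y, hy, z, hz⟩ := (mem_prefixIdeal_succ_smul X i _).1 hk
    have h0 : g (f k) = 0 := hfg.apply_apply_eq_zero k
    have h1 : X i • g z = -g y := by
      rw [← hz, map_add, map_smul] at h0
      exact eq_neg_of_add_eq_zero_right h0
    -- Regularity on `M` corrects `z` by some `z'` in I_iF so that `z - z'` comes from `K`;
    -- subtracting X_i times that element reduces to the induction hypothesis.
    have h2 : g z ∈ prefixIdeal X i • (⊤ : Submodule A M) := by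
      refine hM i (by omega) _ ?_
      rw [h1]
      exact neg_mem (map_mem_smul_top g hy)
    have h3 : g z ∈ (prefixIdeal X i • (⊤ : Submodule A F)).map g := by
      rwa [Submodule.map_smul'', Submodule.map_top, LinearMap.range_eq_top.2 hg]
    obtain ⟨z', hz', hgz⟩ := h3
    obtain ⟨k', hk'⟩ := (hfg (z - z')).1 (by rw [map_sub, hgz, sub_self])
    have h4 : f (k - X i • k') = y + X i • z' := by
      rw [map_sub, map_smul, hk', ← hz, smul_sub]
      abel
    refine (mem_prefixIdeal_succ_smul X i _).2 ⟨k - X i • k', ih _ ?_, k', sub_add_cancel _ _⟩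
    rw [h4]
    exact add_mem hy (Submodule.smul_mem _ _ hz')

/-- The depth lemma: passing to a syzygy gains one step of regularity, because regularity on `F`
restricts to `K` once I_iF ∩ K = I_iK. -/
theorem RegularUpTo.ker {j : ℕ} (hj : j ≤ d) (hM : RegularUpTo X j M) (hF : RegularUpTo X (j + 1) F)
    (hf : Function.Injective f) (hfg : Function.Exact f g) (hg : Function.Surjective g) :
    RegularUpTo X (j + 1) K := by
  intro i hi k hk
  refine hM.mem_of_map_mem hj hf hfg hg (Nat.lt_succ_iff.1 hi) k (hF i hi _ ?_)
  rw [← map_smul]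
  exact map_mem_smul_top f hk

end Exact

end PrefixRegular

/-! ### Regularity of the coordinate functions -/

section CoordRegular

variable {n : ℕ} {V : Type u} [AddCommGroup V] [Module ℂ V] {d : ℕ} (b : Module.Basis (Fin d) ℂ V)

theorem regularUpTo_coordX (j : ℕ) : RegularUpTo (coordX b) j (CoordRing V) := by
  have hmem : ∀ (i : ℕ) (p : CoordRing V),
      p ∈ prefixIdeal (coordX b) i • (⊤ : Submodule (CoordRing V) (CoordRing V)) ↔
      coordEquiv b p ∈ Ideal.span (MvPolynomial.X '' {k : Fin d | (k : ℕ) < i} :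
        Set (MvPolynomial (Fin d) ℂ)) := by
    intro i p
    have h1 : Ideal.span (MvPolynomial.X '' {k : Fin d | (k : ℕ) < i} :
        Set (MvPolynomial (Fin d) ℂ)) = (prefixIdeal (coordX b) i).map (coordEquiv b) := by
      rw [prefixIdeal, Ideal.map_span, Set.image_image]
      simp only [coordEquiv_coordX]
    rw [smul_eq_mul, Ideal.mul_top, h1]
    constructor
    · exact fun h => Ideal.mem_map_of_mem _ h
    · intro h
      obtain ⟨q, hq, hqp⟩ := (Ideal.mem_map_iff_of_surjective _ (coordEquiv b).surjective).1 h
      rwa [← (coordEquiv b).injective hqp]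
  intro i _ m hm
  rw [hmem] at hm ⊢
  rw [smul_eq_mul, map_mul, coordEquiv_coordX, MvPolynomial.mem_ideal_span_X_image] at hm
  rw [MvPolynomial.mem_ideal_span_X_image]
  intro a ha
  -- The ideal is monomial: a variable X_k with k < i dividing X_i·X^a differs from X_i, hence
  -- divides X^a.
  obtain ⟨k, hk, hk0⟩ := hm (Finsupp.single i 1 + a) (by
    rw [MvPolynomial.mem_support_iff, MvPolynomial.coeff_X_mul]
    exact MvPolynomial.mem_support_iff.1 ha)
  refine ⟨k, hk, ?_⟩
  have : i ≠ k := by rintro rfl; exact lt_irrefl (i : ℕ) hk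
  simpa [Finsupp.single_apply, this] using hk0

end CoordRegular

/-! ### Resolutions, generation of K_T(V) by vector bundles, and uniqueness of the pullback -/

namespace EquivModule

variable {n : ℕ} {V : Type u} [AddCommGroup V] [Module ℂ V] {ρ : Representation ℂ (Torus n) V}

/-- The additive relation in the Grothendieck group. -/
theorem kClass_of_isShortExact {M' M M'' : EquivModule ρ} (h : IsShortExact M' M M'') :
    M.kClass = M'.kClass + M''.kClass := by
  have h1 : ((FreeAbelianGroup.of M - FreeAbelianGroup.of M' - FreeAbelianGroup.of M'' :
      FreeAbelianGroup (EquivModule ρ)) : KGroup ρ) = 0 :=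
    (QuotientAddGroup.eq_zero_iff _).2 (AddSubgroup.subset_closure ⟨M', M, M'', h, rfl⟩)
  have h2 : M.kClass - M'.kClass - M''.kClass = 0 := h1
  rw [sub_sub, sub_eq_zero] at h2
  exact h2

theorem mkQ_smul (M : EquivModule ρ) (f : CoordRing V) (m : M.carrier) :
    M.originSubmodule.mkQ (f • m) = evalZero V f • M.originSubmodule.mkQ m := by
  have h : f • m - evalZero V f • m ∈ M.originSubmodule := by
    have h1 : f • m - evalZero V f • m = (f - algebraMap ℂ (CoordRing V) (evalZero V f)) • m := by
      rw [sub_smul, algebraMap_smul]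
    have h2 : f - algebraMap ℂ (CoordRing V) (evalZero V f) ∈ originIdeal V := by
      change evalZero V _ = 0
      rw [map_sub, AlgHom.commutes, Algebra.algebraMap_self, RingHom.id_apply, sub_self]
    have h3 : (f - algebraMap ℂ (CoordRing V) (evalZero V f)) • m ∈
        originIdeal V • (⊤ : Submodule (CoordRing V) M.carrier) :=
      Submodule.smul_mem_smul h2 trivial
    rw [h1]
    exact h3
  rw [← map_smul]
  exact (Submodule.Quotient.eq M.originSubmodule).2 h

variable [FiniteDimensional ℂ V]

theorem rep_mem_ker_freeMap (hρ : IsRational ρ) (M : EquivModule ρ) {k : ℕ}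
    {m : Fin k → M.carrier} {w : Fin k → CharGroup n} (hm : ∀ i, m i ∈ weightSpace M.rep (w i)) :
    ∀ t, ∀ f ∈ LinearMap.ker (M.freeMap m),
      (free hρ w).rep t f ∈ LinearMap.ker (M.freeMap m) := by
  intro t f hf
  have h0 : M.freeMap m f = 0 := hf
  change M.freeMap m ((free hρ w).rep t f) = 0
  rw [freeMap_rep hρ M hm, h0, map_zero]

/-- The module of relations between weight vectors. -/
def relations (hρ : IsRational ρ) (M : EquivModule ρ) {k : ℕ}
    {m : Fin k → M.carrier} {w : Fin k → CharGroup n} (hm : ∀ i, m i ∈ weightSpace M.rep (w i)) :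
    EquivModule ρ :=
  (free hρ w).sub (LinearMap.ker (M.freeMap m)) (rep_mem_ker_freeMap hρ M hm)

theorem isShortExact_relations (hρ : IsRational ρ) (M : EquivModule ρ) {k : ℕ}
    {m : Fin k → M.carrier} {w : Fin k → CharGroup n} (hm : ∀ i, m i ∈ weightSpace M.rep (w i))
    (hspan : Submodule.span (CoordRing V) (Set.range m) = ⊤) :
    IsShortExact (relations hρ M hm) (free hρ w) M := by
  have hex := LinearMap.exact_subtype_ker_map (M.freeMap m)
  have hs := LinearMap.range_eq_top.1 ((M.range_freeMap m).trans hspan)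
  exact ⟨(LinearMap.ker (M.freeMap m)).subtype, M.freeMap m, fun _ _ => rfl,
    fun t f => freeMap_rep hρ M hm t f, Submodule.injective_subtype _, hex, hs⟩

theorem projective_free (hρ : IsRational ρ) {k : ℕ} (w : Fin k → CharGroup n) :
    Module.Projective (CoordRing V) (free hρ w).carrier :=
  inferInstanceAs (Module.Projective (CoordRing V) (Fin k → CoordRing V))

variable {d : ℕ} {b : Module.Basis (Fin d) ℂ V} {β : Fin d → CharGroup n} {ℓ : CharGroup n →+ ℝ}

-- Graded Nakayama for generators: the submodule `N` they span is T-stable, since they are weight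
-- vectors, and M/N equals 𝔫 times itself.
omit [FiniteDimensional ℂ V] in
theorem span_eq_top_of_mkQ (hb : ∀ i, b i ∈ weightSpace ρ (β i)) (hℓ : ∀ i, 0 < ℓ (β i))
    (M : EquivModule ρ) {ι : Type*} {m : ι → M.carrier} {w : ι → CharGroup n}
    (hm : ∀ i, m i ∈ weightSpace M.rep (w i))
    (hspan : Submodule.span ℂ (Set.range fun i => M.originSubmodule.mkQ (m i)) = ⊤) :
    Submodule.span (CoordRing V) (Set.range m) = ⊤ := by
  set N := Submodule.span (CoordRing V) (Set.range m) with hN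
  have hst : ∀ t, ∀ x ∈ N, M.rep t x ∈ N := by
    intro t x hx
    induction hx using Submodule.span_induction with
    | mem x hx =>
      obtain ⟨i, rfl⟩ := hx
      rw [hm i t, ← algebraMap_smul (CoordRing V)]
      exact N.smul_mem _ (Submodule.subset_span ⟨i, rfl⟩)
    | zero => rw [map_zero]; exact zero_mem _
    | add x y _ _ hx hy => rw [map_add]; exact add_mem hx hy
    | smul a x _ hx => rw [M.rep_smul]; exact N.smul_mem _ hx
  have hle : Submodule.span ℂ (Set.range m) ≤ N.restrictScalars ℂ := by
    rw [Submodule.span_le]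
    rintro _ ⟨i, rfl⟩
    exact Submodule.subset_span ⟨i, rfl⟩
  have key := (M.quot N hst).eq_zero_of_originIdeal_smul_eq_top hb hℓ (by
    rw [eq_top_iff]
    intro y _
    obtain ⟨x, rfl⟩ := N.mkQ_surjective y
    have h1 : M.originSubmodule.mkQ x ∈
        (Submodule.span ℂ (Set.range m)).map M.originSubmodule.mkQ := by
      rw [Submodule.map_span, ← Set.range_comp]
      exact (congrArg (M.originSubmodule.mkQ x ∈ ·) hspan).mpr trivial
    obtain ⟨z, hz, hzx⟩ := h1
    have h2 : x - z ∈ M.originSubmodule := by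
      rw [← Submodule.Quotient.mk_eq_zero, Submodule.Quotient.mk_sub]
      exact sub_eq_zero.2 hzx.symm
    have h3 : N.mkQ x = N.mkQ (x - z) := by
      rw [map_sub, (Submodule.Quotient.mk_eq_zero N).2 (hle hz) |> (show N.mkQ z = 0 from ·),
        sub_zero]
    rw [h3]
    exact map_mem_smul_top (A := CoordRing V) N.mkQ h2)
  rw [eq_top_iff]
  intro x _
  exact (Submodule.Quotient.mk_eq_zero N).1 (key (N.mkQ x))

/-- Lift a basis of the fibre M/𝔫M to weight vectors of M. They generate by Nakayama. Their relation
module K lies in 𝔫F, and regularity gives K ∩ 𝔫F = 𝔫K, so K = 𝔫K vanishes and M is free. -/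
theorem projective_of_regularUpTo (hρ : IsRational ρ) (hb : ∀ i, b i ∈ weightSpace ρ (β i))
    (hℓ : ∀ i, 0 < ℓ (β i)) (M : EquivModule ρ) (hM : RegularUpTo (coordX b) d M.carrier) :
    Module.Projective (CoordRing V) M.carrier := by
  obtain ⟨k, m, w, hm, hspan⟩ := M.exists_generators
  have hspanQ : Submodule.span ℂ (Set.range fun i => M.originSubmodule.mkQ (m i)) = ⊤ := by
    rw [eq_top_iff]
    intro y _
    obtain ⟨x, rfl⟩ := M.originSubmodule.mkQ_surjective y
    have hx : x ∈ Submodule.span (CoordRing V) (Set.range m) := by rw [hspan]; trivial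
    induction hx using Submodule.span_induction with
    | mem x hx =>
      obtain ⟨i, rfl⟩ := hx
      exact Submodule.subset_span ⟨i, rfl⟩
    | zero => rw [map_zero]; exact zero_mem _
    | add x y _ _ hx hy => rw [map_add]; exact add_mem (hx trivial) (hy trivial)
    | smul a x _ hx => rw [mkQ_smul]; exact Submodule.smul_mem _ _ (hx trivial)
  obtain ⟨κ, a, ha, hsp, hli⟩ := exists_linearIndependent' ℂ
    fun i => M.originSubmodule.mkQ (m i)
  have : Finite κ := Finite.of_injective a ha
  obtain ⟨k', ⟨e⟩⟩ := Finite.exists_equiv_fin κ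
  let a' : Fin k' → Fin k := a ∘ e.symm
  have hm' : ∀ i, m (a' i) ∈ weightSpace M.rep (w (a' i)) := fun i => hm _
  have hli' : LinearIndependent ℂ fun i => M.originSubmodule.mkQ (m (a' i)) :=
    hli.comp e.symm e.symm.injective
  have hsp' : Submodule.span ℂ (Set.range fun i => M.originSubmodule.mkQ (m (a' i))) = ⊤ := by
    rw [← hspanQ, ← hsp]
    exact congrArg _ (e.symm.surjective.range_comp (fun i => M.originSubmodule.mkQ (m (a i))))
  have hgen := M.span_eq_top_of_mkQ hb hℓ hm' hsp'
  have hsurj : Function.Surjective (M.freeMap fun i => m (a' i)) := by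
    rw [← LinearMap.range_eq_top, range_freeMap, hgen]
  have htop : originIdeal V • (⊤ : Submodule (CoordRing V)
      (LinearMap.ker (M.freeMap fun i => m (a' i)))) = ⊤ := by
    rw [eq_top_iff]
    rintro ⟨f, hf⟩ -
    rw [originIdeal_eq_span b, ← prefixIdeal_length]
    refine hM.mem_of_map_mem le_rfl (Submodule.injective_subtype _)
      (LinearMap.exact_subtype_ker_map (M.freeMap fun i => m (a' i))) hsurj le_rfl _ ?_
    rw [prefixIdeal_length, ← originIdeal_eq_span b]
    change f ∈ originIdeal V • (⊤ : Submodule (CoordRing V) (Fin k' → CoordRing V))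
    have h1 : ∑ i, f i • m (a' i) = 0 := hf
    have h2 := congrArg M.originSubmodule.mkQ h1
    simp only [map_sum, mkQ_smul, map_zero] at h2
    -- Independence in the fibre forces every coefficient of a relation to vanish at the origin,
    -- that is, to lie in 𝔫.
    have h3 := Fintype.linearIndependent_iff.1 hli' (fun i => evalZero V (f i)) h2
    rw [pi_eq_sum_univ' f]
    exact sum_mem fun i _ => Submodule.smul_mem_smul (h3 i) trivial
  have hzero : ∀ f : LinearMap.ker (M.freeMap fun i => m (a' i)), f = 0 :=
    (relations hρ M hm').eq_zero_of_originIdeal_smul_eq_top hb hℓ htop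
  have hinj : Function.Injective (M.freeMap fun i => m (a' i)) := by
    rw [← LinearMap.ker_eq_bot, Submodule.eq_bot_iff]
    exact fun f hf => congrArg Subtype.val (hzero ⟨f, hf⟩)
  exact Module.Projective.of_equiv (LinearEquiv.ofBijective _ ⟨hinj, hsurj⟩)

/-- The Grothendieck group is generated by the classes of vector bundles. -/
theorem kClass_mem_closure (hρ : IsRational ρ) (hb : ∀ i, b i ∈ weightSpace ρ (β i))
    (hℓ : ∀ i, 0 < ℓ (β i)) (M : EquivModule ρ) :
    M.kClass ∈ AddSubgroup.closure {z : KGroup ρ | ∃ E : EquivModule ρ,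
      Module.Projective (CoordRing V) E.carrier ∧ E.kClass = z} := by
  -- The number `i` counts the syzygies still needed. At i = 0 the module is projective; at i = d
  -- the regularity condition is vacuous.
  have key : ∀ i ≤ d, ∀ M : EquivModule ρ, RegularUpTo (coordX b) (d - i) M.carrier →
      M.kClass ∈ AddSubgroup.closure {z : KGroup ρ | ∃ E : EquivModule ρ,
        Module.Projective (CoordRing V) E.carrier ∧ E.kClass = z} := by
    intro i
    induction i with
    | zero =>
      intro _ M hM
      exact AddSubgroup.subset_closure ⟨M, M.projective_of_regularUpTo hρ hb hℓ hM, rfl⟩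
    | succ i ih =>
      intro hi M hM
      obtain ⟨k, m, w, hm, hspan⟩ := M.exists_generators
      have hse := isShortExact_relations hρ M hm hspan
      have hpr := projective_free hρ w
      have h1 := kClass_of_isShortExact hse
      obtain ⟨f, g, -, -, hf, hfg, hg⟩ := hse
      have h2 := ih (by omega) (relations hρ M hm) (by
        have := hM.ker (by omega) ((regularUpTo_coordX b _).of_projective _) hf hfg hg
        rwa [show d - (i + 1) + 1 = d - i by omega] at this)
      rw [← sub_eq_iff_eq_add'.2 h1]
      exact sub_mem (AddSubgroup.subset_closure ⟨_, hpr, rfl⟩) h2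
  refine key d le_rfl M fun i hi => ?_
  simp at hi

theorem pullback_unique (hρ : IsRational ρ) (hb : ∀ i, b i ∈ weightSpace ρ (β i))
    (hℓ : ∀ i, 0 < ℓ (β i)) {f g : KGroup ρ →+ RepRing n} (hf : IsPullbackToOrigin f)
    (hg : IsPullbackToOrigin g) : f = g := by
  apply QuotientAddGroup.addMonoidHom_ext
  apply FreeAbelianGroup.lift_ext
  intro M
  change f M.kClass = g M.kClass
  refine AddMonoidHom.eqOn_closure (f := f) (g := g) ?_ (M.kClass_mem_closure hρ hb hℓ)
  rintro _ ⟨E, hE, rfl⟩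
  rw [hf E hE, hg E hE]

end EquivModule

/-! ### Characters as functions on the character group -/

section Characters

variable {n : ℕ}

/-- The multiplicity function of a representation with finite-dimensional weight spaces. -/
def charFun {M : Type*} [AddCommMonoid M] [Module ℂ M] (τ : Representation ℂ (Torus n) M) :
    CharGroup n → ℤ := fun μ => Module.finrank ℂ (weightSpace τ μ)

/-- Translation of integral functions on the character group. -/
def translateHom (n : ℕ) : Multiplicative (CharGroup n) →* Module.End ℤ (CharGroup n → ℤ) where
  toFun ν := LinearMap.funLeft ℤ ℤ fun μ => μ - ν.toAdd
  map_one' := by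
    ext φ μ
    simp [LinearMap.funLeft_apply]
  map_mul' ν κ := by
    refine LinearMap.ext fun φ => funext fun μ => ?_
    change φ (μ - (ν.toAdd + κ.toAdd)) = φ (μ - ν.toAdd - κ.toAdd)
    rw [sub_sub]

/-- The action of `R(T)` on integral functions on the character group by convolution. -/
def convAct (n : ℕ) : RepRing n →ₐ[ℤ] Module.End ℤ (CharGroup n → ℤ) :=
  AddMonoidAlgebra.lift ℤ _ _ (translateHom n)

theorem convAct_expR (ν μ : CharGroup n) (φ : CharGroup n → ℤ) :
    convAct n (expR ν) φ μ = φ (μ - ν) := by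
  rw [convAct, expR, AddMonoidAlgebra.lift_single, one_smul]
  rfl

/-- On finitely supported functions the convolution action is multiplication in R(T), which lets
Laurent polynomials be compared with infinite characters. -/
theorem convAct_coeff (P Q : RepRing n) : convAct n P Q.coeff = (P * Q).coeff := by
  induction P using AddMonoidAlgebra.induction_linear with
  | zero => simp
  | add P P' h h' =>
    rw [map_add, LinearMap.add_apply, h, h', add_mul, AddMonoidAlgebra.coeff_add,
      Finsupp.coe_add]
  | single ν r =>
    funext μ
    have h : (AddMonoidAlgebra.single ν r : RepRing n) = r • expR ν := by
      rw [expR, AddMonoidAlgebra.smul_single, smul_eq_mul, mul_one]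
    rw [h, map_smul, LinearMap.smul_apply, Pi.smul_apply, convAct_expR, smul_mul_assoc,
      AddMonoidAlgebra.coeff_smul_apply, expR, AddMonoidAlgebra.coeff_single_mul_apply, one_mul,
      neg_add_eq_sub]

theorem convAct_one_sub_expR_neg (ν μ : CharGroup n) (φ : CharGroup n → ℤ) :
    convAct n (1 - expR (-ν)) φ μ = φ μ - φ (μ + ν) := by
  rw [map_sub, map_one, LinearMap.sub_apply, Pi.sub_apply, convAct_expR, sub_neg_eq_add]
  rfl

theorem expR_add (μ ν : CharGroup n) : expR (μ + ν) = expR μ * expR ν := by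
  rw [expR, expR, expR, AddMonoidAlgebra.single_mul_single, one_mul]

theorem expR_zero : expR (0 : CharGroup n) = 1 := AddMonoidAlgebra.one_def.symm

theorem coeff_expR_of_ne {μ ν : CharGroup n} (h : μ ≠ ν) : (expR μ).coeff ν = 0 :=
  Finsupp.single_eq_of_ne' h

/-- The functions whose support is bounded above. -/
def BoundedSupport (ℓ : CharGroup n →+ ℝ) (φ : CharGroup n → ℤ) : Prop :=
  ∃ C : ℝ, ∀ μ, φ μ ≠ 0 → ℓ μ ≤ C

variable {ℓ : CharGroup n →+ ℝ}

theorem BoundedSupport.sub {φ ψ : CharGroup n → ℤ} (hφ : BoundedSupport ℓ φ)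
    (hψ : BoundedSupport ℓ ψ) : BoundedSupport ℓ (φ - ψ) := by
  obtain ⟨C, hC⟩ := hφ
  obtain ⟨D, hD⟩ := hψ
  refine ⟨max C D, fun μ hμ => ?_⟩
  by_cases h : φ μ = 0
  · refine (hD μ fun h' => hμ ?_).trans (le_max_right _ _)
    rw [Pi.sub_apply, h, h', sub_zero]
  · exact (hC μ h).trans (le_max_left _ _)

theorem boundedSupport_coeff (Q : RepRing n) : BoundedSupport ℓ Q.coeff := by
  refine ⟨∑ μ ∈ Q.coeff.support, |ℓ μ|, fun μ hμ => (le_abs_self _).trans ?_⟩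
  exact Finset.single_le_sum (f := fun μ => |ℓ μ|) (fun _ _ => abs_nonneg _)
    (Finsupp.mem_support_iff.2 hμ)

theorem BoundedSupport.one_sub_expR {φ : CharGroup n → ℤ} (hφ : BoundedSupport ℓ φ)
    (ν : CharGroup n) : BoundedSupport ℓ (convAct n (1 - expR (-ν)) φ) := by
  have h : convAct n (1 - expR (-ν)) φ = φ - fun μ => φ (μ + ν) :=
    funext fun μ => convAct_one_sub_expR_neg ν μ φ
  rw [h]
  refine hφ.sub ?_
  obtain ⟨C, hC⟩ := hφ
  refine ⟨C - ℓ ν, fun μ hμ => ?_⟩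
  have := hC _ hμ
  rw [map_add] at this
  linarith

/-- If `(1 - e^{-ν}) φ` is supported in a set stable under subtracting `ν` and the support of `φ`
is bounded above, then `φ` is supported in this set. -/
theorem support_of_one_sub_expR {φ : CharGroup n → ℤ} (hφ : BoundedSupport ℓ φ)
    {ν : CharGroup n} (hν : 0 < ℓ ν) {W : Set (CharGroup n)} (hW : ∀ μ, μ + ν ∈ W → μ ∈ W)
    (h : ∀ μ, convAct n (1 - expR (-ν)) φ μ ≠ 0 → μ ∈ W) : ∀ μ, φ μ ≠ 0 → μ ∈ W := by
  intro μ hμ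
  by_contra hμW
  obtain ⟨C, hC⟩ := hφ
  -- Outside W the hypothesis reads φ(μ) = φ(μ + ν), and the complement of W is stable under adding
  -- ν. A nonzero value would therefore propagate to arbitrarily large ℓ. For W = ∅ this is
  -- injectivity of 1 - e^{-ν}.
  have key : ∀ k : ℕ, φ (μ + k • ν) = φ μ ∧ μ + k • ν ∉ W := by
    intro k
    induction k with
    | zero => simpa using hμW
    | succ k ih =>
      have h1 : convAct n (1 - expR (-ν)) φ (μ + k • ν) = 0 := by
        by_contra h2
        exact ih.2 (h _ h2)
      rw [convAct_one_sub_expR_neg, sub_eq_zero, ih.1] at h1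
      rw [succ_nsmul, ← add_assoc]
      exact ⟨h1.symm, fun h2 => ih.2 (hW _ h2)⟩
  obtain ⟨k, hk⟩ := exists_nat_gt ((C - ℓ μ) / ℓ ν)
  rw [div_lt_iff₀ hν] at hk
  have := hC (μ + k • ν) (by rwa [(key k).1])
  rw [map_add, map_nsmul, nsmul_eq_mul] at this
  linarith

variable {ι : Type*}

/-- The product `∏ (1 - e^{-β_i})`. -/
def eulerProd (β : ι → CharGroup n) (s : Finset ι) : RepRing n := ∏ i ∈ s, (1 - expR (-β i))

theorem support_of_eulerProd {β : ι → CharGroup n} {s : Finset ι} (hβ : ∀ i ∈ s, 0 < ℓ (β i))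
    {W : Set (CharGroup n)} (hW : ∀ i ∈ s, ∀ μ, μ + β i ∈ W → μ ∈ W) {φ : CharGroup n → ℤ}
    (hφ : BoundedSupport ℓ φ) (h : ∀ μ, convAct n (eulerProd β s) φ μ ≠ 0 → μ ∈ W) :
    ∀ μ, φ μ ≠ 0 → μ ∈ W := by
  classical
  induction s using Finset.induction_on generalizing φ with
  | empty => simpa [eulerProd] using h
  | insert i s hi ih =>
    refine support_of_one_sub_expR hφ (hβ i (by simp)) (hW i (by simp)) ?_
    refine ih (fun j hj => hβ j (by simp [hj])) (fun j hj => hW j (by simp [hj]))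
      (hφ.one_sub_expR _) fun μ hμ => h μ ?_
    rwa [eulerProd, Finset.prod_insert hi, mul_comm, map_mul, Module.End.mul_apply]

/-- The finite support of `Q` guards against the default value 0 that `finsum` takes on infinite
supports. -/
theorem coeff_repClass {M : Type*} [AddCommGroup M] [Module ℂ M]
    {τ : Representation ℂ (Torus n) M} {Q : RepRing n} (hQ : ⇑Q.coeff = charFun τ) :
    repClass τ = Q := by
  have h : ∀ μ : CharGroup n, (Module.finrank ℂ (weightSpace τ μ) : ℤ) • expR μ =
      AddMonoidAlgebra.single μ (Q.coeff μ) := by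
    intro μ
    rw [hQ, expR, AddMonoidAlgebra.smul_single, smul_eq_mul, mul_one]
    rfl
  rw [repClass]
  simp only [h]
  rw [finsum_eq_sum_of_support_subset (s := Q.coeff.support)]
  · exact AddMonoidAlgebra.sum_coeff_single Q
  · intro μ hμ
    simpa using hμ

end Characters

/-! ### Hilbert–Serre theorem and construction of the pullback -/

namespace EquivModule

variable {n : ℕ} {V : Type u} [AddCommGroup V] [Module ℂ V] {ρ : Representation ℂ (Torus n) V}
  {d : ℕ} {b : Module.Basis (Fin d) ℂ V} {β : Fin d → CharGroup n} {ℓ : CharGroup n →+ ℝ}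

theorem boundedSupport_charFun (hb : ∀ i, b i ∈ weightSpace ρ (β i)) (hℓ : ∀ i, 0 < ℓ (β i))
    (M : EquivModule ρ) : BoundedSupport ℓ (charFun M.rep) := by
  obtain ⟨C, hC⟩ := M.exists_weight_bound hb hℓ
  refine ⟨C, fun μ hμ => ?_⟩
  have h : weightSpace M.rep μ ≠ ⊥ := by
    intro h
    apply hμ
    rw [charFun, h, finrank_bot, Nat.cast_zero]
  obtain ⟨m, hm, hm0⟩ := (Submodule.ne_bot_iff _).1 h
  exact hC μ m hm hm0

theorem charFun_of_isShortExact (hb : ∀ i, b i ∈ weightSpace ρ (β i)) (hℓ : ∀ i, 0 < ℓ (β i))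
    {M' M M'' : EquivModule ρ} (h : IsShortExact M' M M'') :
    charFun M.rep = charFun M'.rep + charFun M''.rep := by
  obtain ⟨f, g, hf, hg, hinj, hex, hsurj⟩ := h
  funext μ
  have := M.finiteDimensional_weightSpace hb hℓ μ
  have h := finrank_weightSpace_of_exact (f := f.restrictScalars ℂ) (g := g.restrictScalars ℂ)
    M.rational M''.rational (ShiftEquivariant.of_equivariant hf)
    (ShiftEquivariant.of_equivariant hg) hinj (fun m hm => (hex m).1 hm)
    (fun m' => hex.apply_apply_eq_zero m') hsurj μ
  rw [sub_zero] at h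
  exact congrArg (Nat.cast : ℕ → ℤ) h |>.trans (Nat.cast_add _ _)

/-- Multiplication by a coordinate function. -/
theorem shiftEquivariant_coordX (hb : ∀ i, b i ∈ weightSpace ρ (β i)) (M : EquivModule ρ)
    (i : Fin d) : ShiftEquivariant M.rep M.rep (-β i)
      ((LinearMap.lsmul (CoordRing V) M.carrier (coordX b i)).restrictScalars ℂ) := by
  intro t m
  have h : coordAct ρ t (coordX b i) = _ := coordX_mem b hb i t
  change M.rep t (coordX b i • m) = _ • (coordX b i • M.rep t m)
  rw [M.rep_smul, h, smul_assoc]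

/-- Count dimensions in 0 → K → M → M → C → 0, where the middle map is multiplication by x_i and
shifts weights by -β_i. -/
theorem convAct_charFun_of_exact (hb : ∀ i, b i ∈ weightSpace ρ (β i)) (hℓ : ∀ i, 0 < ℓ (β i))
    {K M C : EquivModule ρ} {i : Fin d} {f : K.carrier →ₗ[CoordRing V] M.carrier}
    {g : M.carrier →ₗ[CoordRing V] C.carrier}
    (hf : ∀ t m, f (K.rep t m) = M.rep t (f m)) (hg : ∀ t m, g (M.rep t m) = C.rep t (g m))
    (hinj : Function.Injective f) (hfX : ∀ m, coordX b i • m = 0 ↔ ∃ k, f k = m)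
    (hgX : ∀ m, g m = 0 ↔ ∃ m', coordX b i • m' = m) (hsurj : Function.Surjective g) :
    convAct n (1 - expR (-β i)) (charFun M.rep) =
      charFun C.rep - convAct n (expR (-β i)) (charFun K.rep) := by
  funext μ
  have := M.finiteDimensional_weightSpace hb hℓ
  have h := finrank_weightSpace_of_exact₄ (i := f.restrictScalars ℂ) (g := g.restrictScalars ℂ)
    M.rational M.rational C.rational (ShiftEquivariant.of_equivariant hf)
    (M.shiftEquivariant_coordX hb i) (ShiftEquivariant.of_equivariant hg) hinj hfX hgX hsurj μ
  rw [sub_neg_eq_add] at h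
  have h' : charFun M.rep μ + charFun K.rep (μ + β i) =
      charFun M.rep (μ + β i) + charFun C.rep μ := by
    simp only [charFun]
    exact_mod_cast h
  rw [convAct_one_sub_expR_neg, Pi.sub_apply, convAct_expR, sub_neg_eq_add]
  linarith

theorem convAct_charFun_of_regular (hb : ∀ i, b i ∈ weightSpace ρ (β i)) (hℓ : ∀ i, 0 < ℓ (β i))
    {M C : EquivModule ρ} {i : Fin d} {g : M.carrier →ₗ[CoordRing V] C.carrier}
    (hg : ∀ t m, g (M.rep t m) = C.rep t (g m)) (hX : ∀ m : M.carrier, coordX b i • m = 0 → m = 0)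
    (hgX : ∀ m, g m = 0 ↔ ∃ m', coordX b i • m' = m) (hsurj : Function.Surjective g) :
    convAct n (1 - expR (-β i)) (charFun M.rep) = charFun C.rep := by
  funext μ
  have := M.finiteDimensional_weightSpace hb hℓ μ
  have h := finrank_weightSpace_of_exact (g := g.restrictScalars ℂ)
    M.rational C.rational (M.shiftEquivariant_coordX hb i) (ShiftEquivariant.of_equivariant hg)
    ((injective_iff_map_eq_zero _).2 hX) (fun m => (hgX m).1) (fun m => (hgX _).2 ⟨m, rfl⟩) hsurj μ
  rw [sub_neg_eq_add] at h
  have h' : charFun M.rep μ = charFun M.rep (μ + β i) + charFun C.rep μ := by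
    simp only [charFun]
    exact_mod_cast h
  rw [convAct_one_sub_expR_neg]
  linarith

theorem rep_coordX_smul (hb : ∀ i, b i ∈ weightSpace ρ (β i)) (M : EquivModule ρ)
    (i : Fin d) (t : Torus n) (m : M.carrier) :
    M.rep t (coordX b i • m) = coordX b i • ((expChar (-β i) t : ℂ) • M.rep t m) := by
  rw [smul_comm (coordX b i)]
  exact M.shiftEquivariant_coordX hb i t m

variable [FiniteDimensional ℂ V]

omit [FiniteDimensional ℂ V] in
theorem rep_mem_ker_coordX (hb : ∀ i, b i ∈ weightSpace ρ (β i)) (M : EquivModule ρ) (i : Fin d) :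
    ∀ t, ∀ m ∈ LinearMap.ker (LinearMap.lsmul (CoordRing V) M.carrier (coordX b i)),
      M.rep t m ∈ LinearMap.ker (LinearMap.lsmul (CoordRing V) M.carrier (coordX b i)) := by
  intro t m hm
  have h0 : coordX b i • m = 0 := hm
  have h := M.shiftEquivariant_coordX hb i t m
  have h1 : (expChar (-β i) t : ℂ) • (coordX b i • M.rep t m) = 0 := by
    rw [← map_zero (M.rep t), ← h0]
    exact h.symm
  exact (smul_eq_zero.1 h1).resolve_left (expChar (-β i) t).ne_zero

omit [FiniteDimensional ℂ V] in
theorem rep_mem_range_coordX (hb : ∀ i, b i ∈ weightSpace ρ (β i)) (M : EquivModule ρ)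
    (i : Fin d) :
    ∀ t, ∀ m ∈ LinearMap.range (LinearMap.lsmul (CoordRing V) M.carrier (coordX b i)),
      M.rep t m ∈ LinearMap.range (LinearMap.lsmul (CoordRing V) M.carrier (coordX b i)) := by
  rintro t _ ⟨m, rfl⟩
  exact ⟨_, (M.rep_coordX_smul hb i t m).symm⟩

/-- The kernel of multiplication by a coordinate function. -/
def kerX (hb : ∀ i, b i ∈ weightSpace ρ (β i)) (M : EquivModule ρ) (i : Fin d) : EquivModule ρ :=
  M.sub _ (M.rep_mem_ker_coordX hb i)

/-- The cokernel of multiplication by a coordinate function. -/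
def cokerX (hb : ∀ i, b i ∈ weightSpace ρ (β i)) (M : EquivModule ρ) (i : Fin d) :
    EquivModule ρ :=
  M.quot _ (M.rep_mem_range_coordX hb i)

theorem convAct_charFun (hb : ∀ i, b i ∈ weightSpace ρ (β i)) (hℓ : ∀ i, 0 < ℓ (β i))
    (M : EquivModule ρ) (i : Fin d) :
    convAct n (1 - expR (-β i)) (charFun M.rep) =
      charFun (M.cokerX hb i).rep - convAct n (expR (-β i)) (charFun (M.kerX hb i).rep) :=
  convAct_charFun_of_exact hb hℓ (i := i)
    (f := (LinearMap.ker (LinearMap.lsmul (CoordRing V) M.carrier (coordX b i))).subtype)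
    (g := (LinearMap.range (LinearMap.lsmul (CoordRing V) M.carrier (coordX b i))).mkQ)
    (fun _ _ => rfl) (fun _ _ => rfl) (Submodule.injective_subtype _)
    (fun m => ⟨fun h => ⟨⟨m, h⟩, rfl⟩, fun ⟨k, hk⟩ => hk ▸ k.2⟩)
    (fun _ => Submodule.Quotient.mk_eq_zero _) (Submodule.mkQ_surjective _)

/-- The Hilbert–Serre theorem: characters of equivariant coherent modules are rational functions. -/
theorem exists_eulerProd_charFun (hb : ∀ i, b i ∈ weightSpace ρ (β i)) (hℓ : ∀ i, 0 < ℓ (β i))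
    (W : AddSubmonoid (CharGroup n)) (s : Finset (Fin d)) (hs : ∀ i ∈ s, -β i ∈ W)
    (M : EquivModule ρ) (hM : ∀ i ∉ s, ∀ m : M.carrier, coordX b i • m = 0)
    (hMW : ∀ μ, charFun M.rep μ ≠ 0 → μ ∈ W) :
    ∃ Q : RepRing n, ⇑Q.coeff = convAct n (eulerProd β s) (charFun M.rep) ∧
      ∀ μ, Q.coeff μ ≠ 0 → μ ∈ W := by
  classical
  induction s using Finset.induction_on generalizing M with
  -- All coordinates act by zero, so M is spanned over ℂ by its finitely many generators and its
  -- character is already finitely supported.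
  | empty =>
    obtain ⟨k, m, w, hm, hspan⟩ := M.exists_generators
    have hfin : (Function.support (charFun M.rep)).Finite := by
      refine (Set.finite_range w).subset fun μ hμ => ?_
      have h : weightSpace M.rep μ ≠ ⊥ := by
        intro h
        apply hμ
        rw [charFun, h, finrank_bot, Nat.cast_zero]
      obtain ⟨x, hx, hx0⟩ := (Submodule.ne_bot_iff _).1 h
      obtain ⟨⟨a, j⟩, h1, h2⟩ := exists_of_mem_weightSpace M.rational (monomial_smul_mem hb M hm)
        (M.span_monomial_smul b hspan x) hx hx0
      have ha : ∀ i, a i = 0 := by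
        intro i
        by_contra hi
        apply h2
        obtain ⟨k, hk⟩ := Nat.exists_eq_succ_of_ne_zero hi
        change (∏ i, coordX b i ^ a i) • m j = 0
        rw [← Finset.mul_prod_erase _ _ (Finset.mem_univ i), hk, pow_succ', mul_assoc, mul_smul,
          hM i (by simp)]
      refine ⟨j, ?_⟩
      rw [← h1]
      simp [ha]
    refine ⟨AddMonoidAlgebra.ofCoeff (Finsupp.ofSupportFinite _ hfin), ?_, hMW⟩
    rw [eulerProd, Finset.prod_empty, map_one]
    rfl
  | insert i s hi ih =>
    have hiW := hs i (by simp)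
    -- Kernel and cokernel of x_i have no weights beyond those of M, since nonnegative
    -- multiplicities add up in exact sequences.
    have hsub : ∀ μ, charFun M.rep μ = 0 →
        charFun (M.kerX hb i).rep μ = 0 ∧ charFun (M.cokerX hb i).rep μ = 0 := by
      intro μ hμ
      have h1 := congrFun (charFun_of_isShortExact hb hℓ
        (M.isShortExact_sub_quot _ (M.rep_mem_ker_coordX hb i))) μ
      have h2 := congrFun (charFun_of_isShortExact hb hℓ
        (M.isShortExact_sub_quot _ (M.rep_mem_range_coordX hb i))) μ
      rw [Pi.add_apply, hμ] at h1 h2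
      have h3 : ∀ N : EquivModule ρ, 0 ≤ charFun N.rep μ := fun N => Nat.cast_nonneg _
      have h4 := h3 (M.sub _ (M.rep_mem_ker_coordX hb i))
      have h5 := h3 (M.quot _ (M.rep_mem_ker_coordX hb i))
      have h6 := h3 (M.sub _ (M.rep_mem_range_coordX hb i))
      have h7 := h3 (M.quot _ (M.rep_mem_range_coordX hb i))
      change charFun (M.sub _ (M.rep_mem_ker_coordX hb i)).rep μ = 0 ∧
        charFun (M.quot _ (M.rep_mem_range_coordX hb i)).rep μ = 0
      constructor <;> linarith
    obtain ⟨Q, hQ, hQW⟩ := ih (fun j hj => hs j (by simp [hj])) (M.cokerX hb i)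
      (fun j hj y => by
        obtain ⟨x, rfl⟩ := Submodule.mkQ_surjective _ y
        refine (Submodule.Quotient.mk_eq_zero _).2 ?_
        by_cases hji : j = i
        · exact ⟨x, by rw [hji]; rfl⟩
        · exact (congrArg (· ∈ _) (hM j (by simp [hj, hji]) x)).mpr (zero_mem _))
      (fun μ hμ => hMW μ fun h => hμ (hsub μ h).2)
    obtain ⟨Q', hQ', hQW'⟩ := ih (fun j hj => hs j (by simp [hj])) (M.kerX hb i)
      (fun j hj y => by
        refine Subtype.ext ?_
        by_cases hji : j = i
        · rw [hji]
          exact y.2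
        · exact hM j (by simp [hj, hji]) _)
      (fun μ hμ => hMW μ fun h => hμ (hsub μ h).1)
    -- Both kernel and cokernel are killed by x_i, so the induction hypothesis provides Q and Q'.
    -- The support stays in W because -β_i ∈ W.
    refine ⟨Q - expR (-β i) * Q', ?_, fun μ hμ => ?_⟩
    · rw [AddMonoidAlgebra.coeff_sub, Finsupp.coe_sub, ← convAct_coeff, hQ, hQ',
        show eulerProd β (insert i s) = eulerProd β s * (1 - expR (-β i)) by
          rw [eulerProd, Finset.prod_insert hi, mul_comm, eulerProd],
        map_mul, Module.End.mul_apply, convAct_charFun hb hℓ, map_sub, ← Module.End.mul_apply,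
        ← Module.End.mul_apply, ← map_mul, ← map_mul, mul_comm]
    · by_contra hμW
      apply hμ
      rw [AddMonoidAlgebra.coeff_sub, Finsupp.sub_apply, expR,
        AddMonoidAlgebra.coeff_single_mul_apply, one_mul, neg_neg]
      rw [show Q.coeff μ = 0 by by_contra h; exact hμW (hQW μ h),
        show Q'.coeff (β i + μ) = 0 from ?_, sub_zero]
      by_contra h
      have := W.add_mem hiW (hQW' _ h)
      rw [neg_add_cancel_left] at this
      exact hμW this

theorem exists_eulerProd_univ (hb : ∀ i, b i ∈ weightSpace ρ (β i)) (hℓ : ∀ i, 0 < ℓ (β i))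
    (M : EquivModule ρ) :
    ∃ Q : RepRing n, ⇑Q.coeff = convAct n (eulerProd β Finset.univ) (charFun M.rep) := by
  obtain ⟨Q, hQ, -⟩ := M.exists_eulerProd_charFun hb hℓ ⊤ Finset.univ (fun _ _ => trivial)
    (fun i hi => absurd (Finset.mem_univ i) hi) (fun _ _ => trivial)
  exact ⟨Q, hQ⟩

/-- The Euler characteristic `∏ (1 - e^{-β_i}) · char M`. -/
def eulerClass (hb : ∀ i, b i ∈ weightSpace ρ (β i)) (hℓ : ∀ i, 0 < ℓ (β i))
    (M : EquivModule ρ) : RepRing n := (M.exists_eulerProd_univ hb hℓ).choose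

theorem coeff_eulerClass (hb : ∀ i, b i ∈ weightSpace ρ (β i)) (hℓ : ∀ i, 0 < ℓ (β i))
    (M : EquivModule ρ) :
    ⇑(M.eulerClass hb hℓ).coeff = convAct n (eulerProd β Finset.univ) (charFun M.rep) :=
  (M.exists_eulerProd_univ hb hℓ).choose_spec

/-- The pullback along the inclusion of the origin. -/
def pullbackHom (hb : ∀ i, b i ∈ weightSpace ρ (β i)) (hℓ : ∀ i, 0 < ℓ (β i)) :
    KGroup ρ →+ RepRing n :=
  QuotientAddGroup.lift _ (FreeAbelianGroup.lift fun M => M.eulerClass hb hℓ) <| by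
    rw [exactRelations, AddSubgroup.closure_le]
    rintro _ ⟨M', M, M'', h, rfl⟩
    change FreeAbelianGroup.lift _ _ = _
    rw [map_sub, map_sub, FreeAbelianGroup.lift_apply_of, FreeAbelianGroup.lift_apply_of,
      FreeAbelianGroup.lift_apply_of]
    apply AddMonoidAlgebra.coeff_injective
    apply DFunLike.coe_injective
    rw [AddMonoidAlgebra.coeff_sub, AddMonoidAlgebra.coeff_sub, Finsupp.coe_sub, Finsupp.coe_sub,
      coeff_eulerClass, coeff_eulerClass, coeff_eulerClass, charFun_of_isShortExact hb hℓ h,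
      map_add, add_sub_cancel_left, sub_self]
    rfl

theorem pullbackHom_kClass (hb : ∀ i, b i ∈ weightSpace ρ (β i)) (hℓ : ∀ i, 0 < ℓ (β i))
    (M : EquivModule ρ) : pullbackHom hb hℓ M.kClass = M.eulerClass hb hℓ := by
  change FreeAbelianGroup.lift _ _ = _
  rw [FreeAbelianGroup.lift_apply_of]

omit [FiniteDimensional ℂ V] in
theorem rep_mem_prefixIdeal_smul (hb : ∀ i, b i ∈ weightSpace ρ (β i)) (M : EquivModule ρ)
    (j : ℕ) : ∀ t, ∀ m ∈ prefixIdeal (coordX b) j • (⊤ : Submodule (CoordRing V) M.carrier),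
      M.rep t m ∈ prefixIdeal (coordX b) j • (⊤ : Submodule (CoordRing V) M.carrier) := by
  intro t m hm
  induction hm using Submodule.smul_induction_on' with
  | smul f hf x _ =>
    rw [M.rep_smul]
    refine Submodule.smul_mem_smul ?_ trivial
    have hle : prefixIdeal (coordX b) j ≤
        (prefixIdeal (coordX b) j).comap (coordAct ρ t : CoordRing V →+* CoordRing V) := by
      conv_lhs => rw [prefixIdeal]
      rw [Ideal.span_le]
      rintro _ ⟨i, hi, rfl⟩
      have h : coordAct ρ t (coordX b i) = _ := coordX_mem b hb i t
      change coordAct ρ t (coordX b i) ∈ prefixIdeal (coordX b) j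
      rw [h, Algebra.smul_def]
      exact Ideal.mul_mem_left _ _ (Ideal.subset_span ⟨i, hi, rfl⟩)
    exact hle hf
  | add x _ y _ hx hy => rw [map_add]; exact add_mem hx hy

theorem charFun_quot_of_eq_bot (hb : ∀ i, b i ∈ weightSpace ρ (β i)) (hℓ : ∀ i, 0 < ℓ (β i))
    (M : EquivModule ρ) {N : Submodule (CoordRing V) M.carrier}
    (hN : ∀ t, ∀ m ∈ N, M.rep t m ∈ N) (h : N = ⊥) :
    charFun (M.quot N hN).rep = charFun M.rep := by
  rw [charFun_of_isShortExact hb hℓ (M.isShortExact_sub_quot N hN), right_eq_add]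
  funext μ
  have h2 : weightSpace (M.sub N hN).rep μ = ⊥ := by
    rw [Submodule.eq_bot_iff]
    rintro ⟨x, hx⟩ -
    exact Subtype.ext ((Submodule.mem_bot _).1 (h ▸ hx))
  rw [charFun, h2, finrank_bot, Nat.cast_zero, Pi.zero_apply]

omit [FiniteDimensional ℂ V] in
theorem convAct_charFun_quot (hb : ∀ i, b i ∈ weightSpace ρ (β i)) (hℓ : ∀ i, 0 < ℓ (β i))
    (M : EquivModule ρ) {N N' : Submodule (CoordRing V) M.carrier}
    (hN : ∀ t, ∀ m ∈ N, M.rep t m ∈ N) (hN' : ∀ t, ∀ m ∈ N', M.rep t m ∈ N') (h : N ≤ N')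
    {i : Fin d} (h1 : ∀ y : M.carrier ⧸ N, coordX b i • y = 0 → y = 0)
    (h2 : ∀ y, Submodule.factor h y = 0 ↔ ∃ z, coordX b i • z = y) :
    convAct n (1 - expR (-β i)) (charFun (M.quot N hN).rep) = charFun (M.quot N' hN').rep :=
  convAct_charFun_of_regular hb hℓ (g := Submodule.factor h)
    (fun t y => by
      obtain ⟨x, rfl⟩ := Submodule.mkQ_surjective _ y
      rfl)
    h1 h2 (Submodule.factor_surjective _)

omit [FiniteDimensional ℂ V] in
theorem charFun_quot_congr (M : EquivModule ρ) {N N' : Submodule (CoordRing V) M.carrier}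
    (h : N = N') (hN : ∀ t, ∀ m ∈ N, M.rep t m ∈ N) (hN' : ∀ t, ∀ m ∈ N', M.rep t m ∈ N') :
    charFun (M.quot N hN).rep = charFun (M.quot N' hN').rep := by
  subst h
  rfl

/-- For a regular sequence the kernels vanish, so each factor 1 - e^{-β_i} merely divides out one
more coordinate. -/
theorem charFun_quot_prefixIdeal (hb : ∀ i, b i ∈ weightSpace ρ (β i)) (hℓ : ∀ i, 0 < ℓ (β i))
    (M : EquivModule ρ) {j : ℕ} (hj : j ≤ d) (hM : RegularUpTo (coordX b) j M.carrier) :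
    convAct n (eulerProd β (Finset.univ.filter fun i => (i : ℕ) < j)) (charFun M.rep) =
      charFun (M.quot _ (M.rep_mem_prefixIdeal_smul hb j)).rep := by
  induction j with
  | zero =>
    have h0 : (Finset.univ.filter fun i : Fin d => (i : ℕ) < 0) = ∅ := by simp
    rw [h0, eulerProd, Finset.prod_empty, map_one, Module.End.one_apply]
    exact (M.charFun_quot_of_eq_bot hb hℓ _ (by rw [prefixIdeal_zero, Submodule.bot_smul])).symm
  | succ j ih =>
    specialize ih (by omega) fun i hi => hM i (by omega)
    obtain ⟨j, rfl⟩ : ∃ j' : Fin d, (j' : ℕ) = j := ⟨⟨j, by omega⟩, rfl⟩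
    have hset : (Finset.univ.filter fun i : Fin d => (i : ℕ) < j + 1) =
        insert j (Finset.univ.filter fun i : Fin d => (i : ℕ) < j) := by
      ext i
      simp only [Finset.mem_filter, Finset.mem_univ, true_and, Finset.mem_insert, Fin.ext_iff]
      omega
    rw [hset, eulerProd, Finset.prod_insert (by simp), map_mul, Module.End.mul_apply,
      ← eulerProd, ih]
    exact M.convAct_charFun_quot hb hℓ _ _ (prefixIdeal_smul_le (coordX b) M.carrier j)
      (hM.smul_eq_zero_quot (Nat.lt_succ_self _))
      (factor_prefixIdeal_eq_zero_iff (coordX b) M.carrier j)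

/-- On a projective module all d coordinates are regular, and dividing them all out leaves the fibre
E/𝔫E. -/
theorem isPullbackToOrigin_pullbackHom (hb : ∀ i, b i ∈ weightSpace ρ (β i))
    (hℓ : ∀ i, 0 < ℓ (β i)) : IsPullbackToOrigin (pullbackHom hb hℓ : KGroup ρ →+ RepRing n) := by
  intro E hE
  rw [pullbackHom_kClass]
  symm
  apply coeff_repClass
  have hset : (Finset.univ : Finset (Fin d)) =
      Finset.univ.filter fun i : Fin d => (i : ℕ) < d := by
    simp
  rw [coeff_eulerClass, hset, E.charFun_quot_prefixIdeal hb hℓ le_rfl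
    ((regularUpTo_coordX b d).of_projective _)]
  have h : prefixIdeal (coordX b) d • (⊤ : Submodule (CoordRing V) E.carrier) =
      originIdeal V • (⊤ : Submodule (CoordRing V) E.carrier) := by
    rw [prefixIdeal_length, originIdeal_eq_span b]
  exact E.charFun_quot_congr h _ fun t m hm => E.originSubmodule_stable t hm

end EquivModule

/-- The inclusion of `M` into the trivial square-zero extension of `R` by `M` factors through `ι`.
That extension requires a right module structure, taken here from the left one. -/
theorem SymmetricAlgebra.ι_injective_of_comm {R M : Type*} [CommRing R] [AddCommGroup M]
    [Module R M] : Function.Injective (SymmetricAlgebra.ι R M) := by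
  let : Module Rᵐᵒᵖ M := Module.compHom _ ((RingHom.id R).fromOpposite mul_comm)
  have : IsCentralScalar R M := ⟨fun r m => rfl⟩
  intro x y h
  have h1 := congrArg (SymmetricAlgebra.lift (TrivSqZeroExt.inrHom R M)) h
  rw [SymmetricAlgebra.lift_ι_apply, SymmetricAlgebra.lift_ι_apply] at h1
  exact TrivSqZeroExt.inr_injective h1

/-! ### Weight bases and indecomposable weights -/

section WeightBasis

variable {n : ℕ} {V : Type*} [AddCommGroup V] [Module ℂ V]

/-- Weight projections give independence; one-dimensionality of the weight spaces gives spanning and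
makes the weights of the basis distinct. -/
theorem exists_weight_basis [FiniteDimensional ℂ V] {ρ : Representation ℂ (Torus n) V}
    (hρ : IsRational ρ) (hone : ∀ β ∈ weights ρ, Module.finrank ℂ (weightSpace ρ β) = 1) :
    ∃ (d : ℕ) (b : Module.Basis (Fin d) ℂ V) (β : Fin d → CharGroup n),
      Function.Injective β ∧ Set.range β = weights ρ ∧ ∀ i, b i ∈ weightSpace ρ (β i) := by
  choose v hv hv0 using fun β : weights ρ => (Submodule.ne_bot_iff _).1 β.2
  have hli : LinearIndependent ℂ v := by
    refine linearIndependent_iff'.2 fun s g hg i hi => ?_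
    have h := congrArg (weightProj hρ (i : CharGroup n)) hg
    rw [map_sum, map_zero, Finset.sum_eq_single i] at h
    · rw [map_smul, weightProj_of_mem hρ (hv i)] at h
      exact (smul_eq_zero.1 h).resolve_right (hv0 i)
    · intro j _ hj
      rw [map_smul, weightProj_of_mem_ne hρ (hv j) fun h' => hj (Subtype.ext h'), smul_zero]
    · exact fun h' => absurd hi h'
  have hsp : ⊤ ≤ Submodule.span ℂ (Set.range v) := by
    intro x _
    induction x using hρ.induction_on with
    | zero => exact zero_mem _
    | add x y hx hy => exact add_mem (hx trivial) (hy trivial)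
    | mem μ x hx =>
      by_cases hμ : μ ∈ weights ρ
      · obtain ⟨c, hc⟩ := (finrank_eq_one_iff_of_nonzero' (⟨v ⟨μ, hμ⟩, hv ⟨μ, hμ⟩⟩ : weightSpace ρ μ)
          fun h => hv0 ⟨μ, hμ⟩ (congrArg Subtype.val h)).1 (hone μ hμ) ⟨x, hx⟩
        rw [← show c • v ⟨μ, hμ⟩ = x from congrArg Subtype.val hc]
        exact Submodule.smul_mem _ _ (Submodule.subset_span ⟨_, rfl⟩)
      · rw [weights, Set.mem_ofPred_eq, not_not] at hμ
        rw [hμ] at hx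
        rw [(Submodule.mem_bot _).1 hx]
        exact zero_mem _
  let b := Module.Basis.mk hli hsp
  have : Finite (weights ρ) := Module.Finite.finite_basis b
  obtain ⟨d, ⟨e⟩⟩ := Finite.exists_equiv_fin (weights ρ)
  refine ⟨d, b.reindex e, fun i => e.symm i, Subtype.val_injective.comp e.symm.injective, ?_,
    fun i => ?_⟩
  · rw [show (fun i => ((e.symm i : weights ρ) : CharGroup n)) = Subtype.val ∘ e.symm from rfl,
      e.symm.surjective.range_comp, Subtype.range_coe]
  · rw [Module.Basis.reindex_apply, Module.Basis.mk_apply]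
    exact hv _

theorem InHalfSpace.exists_addMonoidHom {Φ : Set (CharGroup n)} (h : InHalfSpace Φ) :
    ∃ ℓ : CharGroup n →+ ℝ, ∀ β ∈ Φ, 0 < ℓ β := by
  obtain ⟨ℓ, hℓ⟩ := h
  refine ⟨⟨⟨fun μ => ℓ fun i => (μ i : ℝ), ?_⟩, fun μ ν => ?_⟩, hℓ⟩
  · rw [← map_zero ℓ]
    exact congrArg ℓ (funext fun i => by simp)
  · rw [← map_add]
    exact congrArg ℓ (funext fun i => by simp)

variable {d : ℕ} {β : Fin d → CharGroup n} {ℓ : CharGroup n →+ ℝ}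

/-- An indecomposable weight is a combination of weights only in the trivial way. -/
theorem eq_single_of_sum_eq (hinj : Function.Injective β) (hℓ : ∀ i, 0 < ℓ (β i)) {i₀ : Fin d}
    (hind : ¬ IntegrallyDecomposable (Set.range β) (β i₀)) {a : Fin d → ℕ}
    (ha : ∑ i, a i • β i = β i₀) : a = Pi.single i₀ 1 := by
  classical
  -- Otherwise the nonzero coefficients exhibit a decomposition of `β i₀`; it is nonempty because ℓ
  -- (β i₀) > 0. Coefficients are transported to characters by `Function.invFun β`.
  have h0 : a i₀ ≠ 0 := by
    intro h0
    apply hind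
    have hsum : ∑ i ∈ Finset.univ.filter (fun i => a i ≠ 0), a i • β i = β i₀ := by
      rw [← ha]
      refine Finset.sum_subset (Finset.filter_subset _ _) fun i _ hi => ?_
      have : a i = 0 := by simpa using hi
      rw [this, zero_smul]
    have : Nonempty (Fin d) := ⟨i₀⟩
    refine ⟨(Finset.univ.filter fun i => a i ≠ 0).image β, fun γ => a (Function.invFun β γ),
      ?_, ?_, ?_, ?_⟩
    · rw [Finset.image_nonempty, Finset.nonempty_iff_ne_empty]
      intro he
      rw [he, Finset.sum_empty] at hsum
      have := hℓ i₀
      rw [← hsum, map_zero] at this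
      exact lt_irrefl _ this
    · intro γ hγ
      obtain ⟨i, hi, rfl⟩ := Finset.mem_image.1 hγ
      refine ⟨⟨i, rfl⟩, fun h => (Finset.mem_filter.1 hi).2 ?_⟩
      rw [hinj h, h0]
    · intro γ hγ
      obtain ⟨i, hi, rfl⟩ := Finset.mem_image.1 hγ
      change 0 < a (Function.invFun β (β i))
      rw [Function.leftInverse_invFun hinj i]
      exact Nat.pos_of_ne_zero (Finset.mem_filter.1 hi).2
    · rw [Finset.sum_image fun i _ j _ h => hinj h, ← hsum]
      refine Finset.sum_congr rfl fun i _ => ?_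
      change _ = a (Function.invFun β (β i)) • β i
      rw [Function.leftInverse_invFun hinj i]
  have hℓsum := congrArg ℓ ha
  rw [map_sum] at hℓsum
  simp only [map_nsmul] at hℓsum
  simp only [nsmul_eq_mul] at hℓsum
  rw [← Finset.add_sum_erase _ _ (Finset.mem_univ i₀)] at hℓsum
  have h1 : (1 : ℝ) ≤ a i₀ := by exact_mod_cast Nat.one_le_iff_ne_zero.2 h0
  have h2 : ∀ i ∈ Finset.univ.erase i₀, 0 ≤ (a i : ℝ) * ℓ (β i) := fun i _ =>
    mul_nonneg (Nat.cast_nonneg _) (hℓ i).le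
  have h3 := Finset.sum_nonneg h2
  have h4 := hℓ i₀
  -- With a i₀ ≥ 1, the i₀-term alone already contributes at least ℓ (β i₀), leaving nothing for the
  -- others.
  have h5 : ∑ i ∈ Finset.univ.erase i₀, (a i : ℝ) * ℓ (β i) = 0 := by nlinarith
  have h6 : (a i₀ : ℝ) = 1 := by
    rw [h5, add_zero] at hℓsum
    exact mul_right_cancel₀ h4.ne' (hℓsum.trans (one_mul _).symm)
  funext i
  by_cases hi : i = i₀
  · subst hi
    rw [Pi.single_eq_same]
    exact_mod_cast h6
  · rw [Pi.single_eq_of_ne hi]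
    have := (Finset.sum_eq_zero_iff_of_nonneg h2).1 h5 i (by simp [hi])
    exact_mod_cast (mul_eq_zero.1 this).resolve_right (hℓ i).ne'

theorem sum_nsmul_neg (a : Fin d → ℕ) (β : Fin d → CharGroup n) :
    ∑ i, a i • -β i = -∑ i, a i • β i := by
  simp only [smul_neg, Finset.sum_neg_distrib]

/-- A product of coordinate functions whose weight is minus an indecomposable weight has only one
factor. -/
theorem eq_one_of_sum_neg_eq (hinj : Function.Injective β) (hℓ : ∀ i, 0 < ℓ (β i)) {i₀ : Fin d}
    (hind : ¬ IntegrallyDecomposable (Set.range β) (β i₀)) {k : ℕ} {f : Fin k → Fin d}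
    (hf : ∑ j, -β (f j) = -β i₀) : k = 1 ∧ ∀ j, f j = i₀ := by
  classical
  -- Collect equal factors: the exponent of each coordinate is the size of the corresponding fibre
  -- of `f`.
  have h1 : ∑ i, (Finset.univ.filter fun j => f j = i).card • β i = β i₀ := by
    rw [Finset.sum_neg_distrib, neg_inj] at hf
    rw [← hf, ← Finset.sum_fiberwise Finset.univ f]
    refine Finset.sum_congr rfl fun i _ => ?_
    rw [Finset.sum_congr rfl fun j hj => by rw [(Finset.mem_filter.1 hj).2], Finset.sum_const]
  have h2 := eq_single_of_sum_eq hinj hℓ hind h1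
  constructor
  · have h3 : ∑ i, (Finset.univ.filter fun j => f j = i).card = k := by
      rw [← Finset.card_eq_sum_card_fiberwise fun _ _ => Finset.mem_coe.2 (Finset.mem_univ _),
        Finset.card_univ, Fintype.card_fin]
    rw [← h3]
    simp only [fun i => congrFun h2 i, Finset.sum_pi_single', Finset.mem_univ, if_true]
  · intro j
    by_contra hj
    have h3 := congrFun h2 (f j)
    rw [Pi.single_eq_of_ne hj, Finset.card_eq_zero] at h3
    exact Finset.notMem_empty j (h3 ▸ Finset.mem_filter.2 ⟨Finset.mem_univ j, rfl⟩)

/-- The submonoid generated by the negatives of all weights but one. -/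
def negCone (β : Fin d → CharGroup n) (i₀ : Fin d) : AddSubmonoid (CharGroup n) :=
  AddSubmonoid.closure ((fun i => -β i) '' {i | i ≠ i₀})

theorem neg_notMem_negCone (hinj : Function.Injective β) (hℓ : ∀ i, 0 < ℓ (β i)) {i₀ : Fin d}
    (hind : ¬ IntegrallyDecomposable (Set.range β) (β i₀)) : -β i₀ ∉ negCone β i₀ := by
  classical
  intro h
  have key : ∀ μ ∈ negCone β i₀, ∃ a : Fin d → ℕ, a i₀ = 0 ∧ μ = ∑ i, a i • -β i := by
    intro μ hμ
    induction hμ using AddSubmonoid.closure_induction with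
    | mem x hx =>
      obtain ⟨i, hi, rfl⟩ := hx
      refine ⟨Pi.single i 1, Pi.single_eq_of_ne (Ne.symm hi) _, ?_⟩
      rw [Finset.sum_eq_single i]
      · simp
      · intro j _ hj
        rw [Pi.single_eq_of_ne hj, zero_smul]
      · simp
    | zero => exact ⟨0, rfl, by simp⟩
    | add x y _ _ hx hy =>
      obtain ⟨a, ha, rfl⟩ := hx
      obtain ⟨a', ha', rfl⟩ := hy
      refine ⟨a + a', by simp [ha, ha'], ?_⟩
      simp only [Pi.add_apply, add_smul, Finset.sum_add_distrib]
  obtain ⟨a, ha, h1⟩ := key _ h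
  rw [sum_nsmul_neg, neg_inj] at h1
  rw [eq_single_of_sum_eq hinj hℓ hind h1.symm, Pi.single_eq_same] at ha
  exact one_ne_zero ha

/-- The subring is the monoid ring of `negCone β i₀`, which turns membership of the cofactor into a
support condition. -/
theorem mem_expSubring_iff (hinj : Function.Injective β) {i₀ : Fin d} (Q : RepRing n) :
    Q ∈ expSubring (Set.range β \ {β i₀}) ↔ ∀ μ, Q.coeff μ ≠ 0 → μ ∈ negCone β i₀ := by
  classical
  constructor
  · intro hQ
    induction hQ using Subring.closure_induction with
    | mem x hx =>
      obtain ⟨_, ⟨⟨i, rfl⟩, hi⟩, rfl⟩ := hx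
      intro μ hμ
      by_cases h : -β i = μ
      · exact h ▸ AddSubmonoid.subset_closure ⟨i, fun h' => hi (congrArg β h'), rfl⟩
      · exact absurd (coeff_expR_of_ne h) hμ
    | zero => exact fun μ hμ => absurd rfl hμ
    | one =>
      intro μ hμ
      by_cases h : 0 = μ
      · exact h ▸ zero_mem _
      · rw [← expR_zero] at hμ
        exact absurd (coeff_expR_of_ne h) hμ
    | add x y _ _ hx hy =>
      intro μ hμ
      by_cases h : x.coeff μ = 0
      · refine hy μ fun h' => hμ ?_
        rw [AddMonoidAlgebra.coeff_add, Finsupp.add_apply, h, h', add_zero]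
      · exact hx μ h
    | neg x _ hx =>
      intro μ hμ
      exact hx μ fun h => hμ (by rw [AddMonoidAlgebra.coeff_neg, Finsupp.neg_apply, h, neg_zero])
    | mul x y _ _ hx hy =>
      intro μ hμ
      have h := AddMonoidAlgebra.support_coeff_mul_subset x y (Finsupp.mem_support_iff.2 hμ)
      obtain ⟨κ, hκ, ν, hν, rfl⟩ := Finset.mem_add.1 h
      exact add_mem (hx κ (Finsupp.mem_support_iff.1 hκ)) (hy ν (Finsupp.mem_support_iff.1 hν))
  · intro h
    have hexp : ∀ μ ∈ negCone β i₀, expR μ ∈ expSubring (Set.range β \ {β i₀}) := by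
      intro μ hμ
      induction hμ using AddSubmonoid.closure_induction with
      | mem x hx =>
        obtain ⟨i, hi, rfl⟩ := hx
        exact Subring.subset_closure ⟨β i, ⟨⟨i, rfl⟩, fun h' => hi (hinj h')⟩, rfl⟩
      | zero => exact expR_zero (n := n) ▸ one_mem _
      | add x y _ _ hx hy => exact expR_add x y ▸ mul_mem hx hy
    rw [← AddMonoidAlgebra.sum_coeff_single Q]
    refine sum_mem fun μ hμ => ?_
    have h1 : (AddMonoidAlgebra.single μ (Q.coeff μ) : RepRing n) = Q.coeff μ • expR μ := by
      rw [expR, AddMonoidAlgebra.smul_single, smul_eq_mul, mul_one]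
    rw [h1]
    exact zsmul_mem (hexp μ (h μ (Finsupp.mem_support_iff.1 hμ))) _

end WeightBasis

/-! ### Local ring, cotangent space and ideal of Y -/

namespace StableSubscheme

variable {n : ℕ} {V : Type u} [AddCommGroup V] [Module ℂ V] {ρ : Representation ℂ (Torus n) V}
  {d : ℕ} {b : Module.Basis (Fin d) ℂ V} {β : Fin d → CharGroup n} {ℓ : CharGroup n →+ ℝ}
  (Y : StableSubscheme ρ)

theorem pointIdeal_eq_map : Y.pointIdeal = (originIdeal V).map (Ideal.Quotient.mk Y.ideal) := by
  apply le_antisymm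
  · intro g hg
    obtain ⟨f, rfl⟩ := Ideal.Quotient.mk_surjective g
    exact Ideal.mem_map_of_mem _ hg
  · rw [Ideal.map_le_iff_le_comap]
    exact fun f hf => hf

/-- The germs of the coordinate functions. -/
def germ (b : Module.Basis (Fin d) ℂ V) (i : Fin d) : Y.localRing := Y.linearGerm (b.coord i)

theorem maximalIdeal_eq_map :
    IsLocalRing.maximalIdeal Y.localRing = Y.pointIdeal.map (algebraMap Y.ring Y.localRing) :=
  (IsLocalization.AtPrime.map_eq_maximalIdeal Y.pointIdeal Y.localRing).symm

theorem maximalIdeal_eq_span (b : Module.Basis (Fin d) ℂ V) :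
    IsLocalRing.maximalIdeal Y.localRing = Ideal.span (Set.range (Y.germ b)) := by
  rw [maximalIdeal_eq_map, pointIdeal_eq_map, originIdeal_eq_span b, Ideal.map_span, Ideal.map_span,
    ← Set.range_comp, ← Set.range_comp]
  rfl

/-- Evaluation of germs at the origin. -/
def localEval : Y.localRing →+* ℂ :=
  IsLocalization.lift (M := Y.pointIdeal.primeCompl) (g := (Y.eval : Y.ring →+* ℂ)) fun s =>
    isUnit_iff_ne_zero.2 s.2

theorem localEval_algebraMap (c : ℂ) : Y.localEval (algebraMap ℂ Y.localRing c) = c := by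
  rw [IsScalarTower.algebraMap_apply ℂ Y.ring Y.localRing, localEval, IsLocalization.lift_eq]
  exact Y.eval.commutes c

theorem sub_localEval_mem (r : Y.localRing) :
    r - algebraMap ℂ Y.localRing (Y.localEval r) ∈ IsLocalRing.maximalIdeal Y.localRing := by
  rw [IsLocalRing.mem_maximalIdeal, mem_nonunits_iff]
  intro h
  have h1 := h.map Y.localEval
  rw [map_sub, localEval_algebraMap, sub_self] at h1
  exact not_isUnit_zero h1

/-- The ideal of the origin is maximal, and powers of a maximal ideal are contracted from the
localization. -/
theorem mem_pointIdeal_sq {g : Y.ring}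
    (h : algebraMap Y.ring Y.localRing g ∈ IsLocalRing.maximalIdeal Y.localRing ^ 2) :
    g ∈ Y.pointIdeal ^ 2 := by
  have hmax : Y.pointIdeal.IsMaximal :=
    RingHom.ker_isMaximal_of_surjective _ fun c => ⟨algebraMap ℂ Y.ring c, Y.eval.commutes c⟩
  rw [← IsLocalization.AtPrime.under_maximalIdeal_pow Y.pointIdeal Y.localRing]
  exact h

theorem cotangentMap_eq_zero_of_mem {ξ : Module.Dual ℂ V}
    (h : SymmetricAlgebra.ι ℂ _ ξ ∈ Y.ideal) : Y.cotangentMap ξ = 0 := by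
  have h1 : Y.linearGerm ξ = 0 := by
    change algebraMap Y.ring Y.localRing (Ideal.Quotient.mk Y.ideal _) = 0
    rw [Ideal.Quotient.eq_zero_iff_mem.2 h, map_zero]
  refine (Submodule.Quotient.mk_eq_zero _).2 ?_
  change Y.linearGerm ξ ∈ Y.maxPow 2
  rw [h1]
  exact Submodule.zero_mem _

theorem mk_mem_pointIdeal_sq {ξ : Module.Dual ℂ V} (h : Y.cotangentMap ξ = 0) :
    Ideal.Quotient.mk Y.ideal (SymmetricAlgebra.ι ℂ _ ξ) ∈ Y.pointIdeal ^ 2 := by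
  have h1 : Y.linearGerm ξ ∈ Y.maxPow 2 :=
    (Submodule.Quotient.mk_eq_zero (powSucc Y.localRing 1)).1 h
  exact Y.mem_pointIdeal_sq h1

theorem mk_mem_weightSpace {f : CoordRing V} {μ : CharGroup n}
    (hf : f ∈ weightSpace (algRep (coordAct ρ)) μ) :
    Ideal.Quotient.mk Y.ideal f ∈ weightSpace (algRep Y.act) μ := by
  intro t
  have h : coordAct ρ t f = _ := hf t
  change Y.act t (Ideal.Quotient.mk Y.ideal f) = _
  rw [act_mk, h]
  rfl

-- If `x_α` vanishes in 𝔪/𝔪², its image in ℂ[Y] is a combination of monomials of degree at least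
-- two. If that image were nonzero, one of these monomials would have weight -α, against
-- indecomposability.
open scoped Pointwise in
theorem coordX_mem_ideal [FiniteDimensional ℂ V] (hρ : IsRational ρ)
    (hb : ∀ i, b i ∈ weightSpace ρ (β i))
    (hinj : Function.Injective β) (hℓ : ∀ i, 0 < ℓ (β i)) {i₀ : Fin d}
    (hind : ¬ IntegrallyDecomposable (Set.range β) (β i₀))
    (h : Y.cotangentMap (b.coord i₀) = 0) : coordX b i₀ ∈ Y.ideal := by
  classical
  rw [← Ideal.Quotient.eq_zero_iff_mem]
  by_contra h0
  let v : (Fin d → ℕ) × Fin d × Fin d → CoordRing V := fun p =>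
    coordMonomial b p.1 • (coordX b p.2.1 * coordX b p.2.2)
  have hv : ∀ p, v p ∈ weightSpace (algRep (coordAct ρ))
      (∑ i, p.1 i • -β i + (-β p.2.1 + -β p.2.2)) := fun p =>
    mul_mem_weightSpace (coordMonomial_mem b hb _)
      (mul_mem_weightSpace (coordX_mem b hb _) (coordX_mem b hb _))
  have hspan : ∀ f ∈ originIdeal V ^ 2, f ∈ Submodule.span ℂ (Set.range v) := by
    intro f hf
    rw [originIdeal_eq_span b, pow_two, Ideal.span_mul_span'] at hf
    have h1 := Submodule.span_smul_of_span_eq_top (span_coordMonomial b)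
      (Set.range (coordX b) * Set.range (coordX b))
    have h2 : f ∈ Submodule.span ℂ
        (Set.range (coordMonomial b) • (Set.range (coordX b) * Set.range (coordX b))) := by
      rw [h1]
      exact hf
    refine Submodule.span_mono ?_ h2
    rintro _ ⟨_, ⟨a, rfl⟩, _, ⟨_, ⟨i, rfl⟩, _, ⟨j, rfl⟩, rfl⟩, rfl⟩
    exact ⟨(a, i, j), rfl⟩
  have hmem := Y.mk_mem_pointIdeal_sq h
  rw [pointIdeal_eq_map, ← Ideal.map_pow] at hmem
  obtain ⟨f, hf, hfx⟩ := (Ideal.mem_map_iff_of_surjective _ Ideal.Quotient.mk_surjective).1 hmem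
  have hrat : IsRational (algRep Y.act) := (Y.structureSheaf hρ).rational
  have hx : Ideal.Quotient.mk Y.ideal (coordX b i₀) ∈
      Submodule.span ℂ (Set.range fun p => Ideal.Quotient.mk Y.ideal (v p)) := by
    have h1 : (Ideal.Quotient.mkₐ ℂ Y.ideal).toLinearMap f ∈
        (Submodule.span ℂ (Set.range v)).map (Ideal.Quotient.mkₐ ℂ Y.ideal).toLinearMap :=
      ⟨f, hspan f hf, rfl⟩
    rw [Submodule.map_span, ← Set.range_comp] at h1
    have h2 : Ideal.Quotient.mk Y.ideal (coordX b i₀) =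
        (Ideal.Quotient.mkₐ ℂ Y.ideal).toLinearMap f := hfx.symm
    rw [h2]
    exact h1
  obtain ⟨⟨a, i, j⟩, h1, -⟩ := exists_of_mem_weightSpace hrat
    (fun p => Y.mk_mem_weightSpace (hv p)) hx (Y.mk_mem_weightSpace (coordX_mem b hb i₀)) h0
  have h2 : ∑ k, (a + Pi.single i 1 + Pi.single j 1 : Fin d → ℕ) k • β k = β i₀ := by
    rw [← neg_inj, ← h1, sum_nsmul_neg]
    simp only [Pi.add_apply, add_smul, Finset.sum_add_distrib]
    have hs : ∀ i : Fin d, ∑ k, (Pi.single i 1 : Fin d → ℕ) k • β k = β i := by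
      intro i
      rw [Finset.sum_eq_single i]
      · simp
      · intro k _ hk
        rw [Pi.single_eq_of_ne hk, zero_smul]
      · simp
    rw [hs, hs]
    abel
  -- Comparing total degrees: at least 2 on the left, 1 on the right.
  have h3 := congrArg (fun a : Fin d → ℕ => ∑ k, a k) (eq_single_of_sum_eq hinj hℓ hind h2)
  simp [Finset.sum_add_distrib] at h3

/-! ### Weights of the tangent cone -/

theorem germ_prod_mem (b : Module.Basis (Fin d) ℂ V) {k : ℕ} (f : Fin k → Fin d) :
    ∏ j, Y.germ b (f j) ∈ Y.maxPow k := by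
  change _ ∈ IsLocalRing.maximalIdeal Y.localRing ^ k
  have h : ∀ j, Y.germ b (f j) ∈ IsLocalRing.maximalIdeal Y.localRing := fun j => by
    rw [Y.maximalIdeal_eq_span b]
    exact Ideal.subset_span ⟨_, rfl⟩
  have h2 := Ideal.prod_mem_prod (s := Finset.univ)
    (I := fun _ : Fin k => IsLocalRing.maximalIdeal Y.localRing) fun j _ => h j
  rwa [Finset.prod_const, Finset.card_univ, Fintype.card_fin] at h2

/-- The classes of monomials in the graded pieces of the tangent cone. -/
def grMonomial (b : Module.Basis (Fin d) ℂ V) {k : ℕ} (f : Fin k → Fin d) : Y.grPiece k :=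
  (powSucc Y.localRing k).mkQ ⟨∏ j, Y.germ b (f j), Y.germ_prod_mem b f⟩

theorem germ_mem_weightSpace (hb : ∀ i, b i ∈ weightSpace ρ (β i)) (i : Fin d) :
    Y.germ b i ∈ weightSpace (algRep Y.localAct) (-β i) := by
  intro t
  have h : Y.act t (Ideal.Quotient.mk Y.ideal (coordX b i)) = _ :=
    Y.mk_mem_weightSpace (coordX_mem b hb i) t
  change Y.localAct t (algebraMap Y.ring Y.localRing (Ideal.Quotient.mk Y.ideal (coordX b i))) = _
  rw [localAct_algebraMap, h]
  exact map_smul (IsScalarTower.toAlgHom ℂ Y.ring Y.localRing) _ _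

theorem grMonomial_mem (hb : ∀ i, b i ∈ weightSpace ρ (β i)) {k : ℕ} (f : Fin k → Fin d) :
    Y.grMonomial b f ∈ weightSpace (Y.grRep k) (∑ j, -β (f j)) := by
  intro t
  have h : Y.localAct t (∏ j, Y.germ b (f j)) = _ :=
    prod_mem_weightSpace Finset.univ (fun j => Y.germ_mem_weightSpace hb (f j)) t
  have h1 : powRep Y.localAct k t ⟨∏ j, Y.germ b (f j), Y.germ_prod_mem b f⟩ =
      (expChar (∑ j, -β (f j)) t : ℂ) •
        (⟨∏ j, Y.germ b (f j), Y.germ_prod_mem b f⟩ : Y.maxPow k) := Subtype.ext h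
  exact congrArg (powSucc Y.localRing k).mkQ h1

theorem span_grMonomial (b : Module.Basis (Fin d) ℂ V) (k : ℕ) (y : Y.grPiece k) :
    y ∈ Submodule.span ℂ (Set.range fun f : Fin k → Fin d => Y.grMonomial b f) := by
  obtain ⟨⟨g, hg⟩, rfl⟩ := (powSucc Y.localRing k).mkQ_surjective y
  let v : (Fin k → Fin d) → Y.maxPow k := fun f => ⟨∏ j, Y.germ b (f j), Y.germ_prod_mem b f⟩
  have key : ∀ g ∈ IsLocalRing.maximalIdeal Y.localRing ^ k,
      ∃ z ∈ Submodule.span ℂ (Set.range v),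
        g - (z : Y.localRing) ∈ IsLocalRing.maximalIdeal Y.localRing ^ (k + 1) := by
    intro g hg
    have hpow : IsLocalRing.maximalIdeal Y.localRing ^ k =
        Ideal.span (Set.range fun f : Fin k → Fin d => ∏ j, Y.germ b (f j)) := by
      rw [Y.maximalIdeal_eq_span b]
      refine (Submodule.span_pow _ k).trans (congrArg _ ?_)
      ext x
      rw [Set.mem_pow]
      constructor
      · rintro ⟨f, rfl⟩
        choose e he using fun j => (f j).2
        exact ⟨e, by simp only [he, List.prod_ofFn]⟩
      · rintro ⟨f, rfl⟩
        exact ⟨fun j => ⟨_, f j, rfl⟩, List.prod_ofFn⟩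
    rw [hpow] at hg
    induction hg using Submodule.span_induction with
    | mem x hx =>
      obtain ⟨f, rfl⟩ := hx
      exact ⟨v f, Submodule.subset_span ⟨f, rfl⟩, by rw [sub_self]; exact Submodule.zero_mem _⟩
    | zero => exact ⟨0, Submodule.zero_mem _, by simp⟩
    | add x y _ _ hx hy =>
      obtain ⟨z, hz, h1⟩ := hx
      obtain ⟨w, hw, h2⟩ := hy
      refine ⟨z + w, add_mem hz hw, ?_⟩
      rw [Submodule.coe_add, add_sub_add_comm]
      exact add_mem h1 h2
    | smul r x hx' hx =>
      obtain ⟨z, hz, h1⟩ := hx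
      -- The residue field is ℂ, so modulo 𝔪^(k+1) a coefficient `r` of an element of 𝔪^k may be
      -- replaced by its value at the origin. Generators over the local ring thus span the graded
      -- piece over ℂ.
      refine ⟨Y.localEval r • z, Submodule.smul_mem _ _ hz, ?_⟩
      have h2 : r • x - ((Y.localEval r • z : Y.maxPow k) : Y.localRing) =
          (r - algebraMap ℂ Y.localRing (Y.localEval r)) * x +
          algebraMap ℂ Y.localRing (Y.localEval r) * (x - z) := by
        rw [Submodule.coe_smul, Algebra.smul_def (Y.localEval r), smul_eq_mul]
        ring
      rw [h2]
      refine add_mem ?_ (Ideal.mul_mem_left _ _ h1)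
      rw [pow_succ']
      refine Ideal.mul_mem_mul (Y.sub_localEval_mem r) ?_
      rw [hpow]
      exact hx'
  obtain ⟨z, hz, hgz⟩ := key g hg
  have h1 : (powSucc Y.localRing k).mkQ ⟨g, hg⟩ = (powSucc Y.localRing k).mkQ z :=
    (Submodule.Quotient.eq _).2 hgz
  rw [h1]
  have h2 : (powSucc Y.localRing k).mkQ z ∈
      (Submodule.span ℂ (Set.range v)).map (powSucc Y.localRing k).mkQ := ⟨z, hz, rfl⟩
  rw [Submodule.map_span, ← Set.range_comp] at h2
  exact h2

theorem isRational_grRep (hb : ∀ i, b i ∈ weightSpace ρ (β i)) (k : ℕ) :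
    IsRational (Y.grRep k) :=
  isRational_of_span (fun f : Fin k → Fin d => Y.grMonomial_mem hb f) (Y.span_grMonomial b k)

theorem grMonomial_one (b : Module.Basis (Fin d) ℂ V) (f : Fin 1 → Fin d) :
    Y.grMonomial b f = Y.cotangentMap (b.coord (f 0)) := by
  refine congrArg (powSucc Y.localRing 1).mkQ (Subtype.ext ?_)
  exact Fin.prod_univ_one fun j => Y.germ b (f j)

/-- Among the monomial classes in all degrees, only that of `x_α` in degree one can have weight -α.
-/
theorem cotangentMap_ne_zero (hinj : Function.Injective β) (hℓ : ∀ i, 0 < ℓ (β i)) {i₀ : Fin d}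
    (hind : ¬ IntegrallyDecomposable (Set.range β) (β i₀)) {k : ℕ} {f : Fin k → Fin d}
    (hf : ∑ j, -β (f j) = -β i₀) (h0 : Y.grMonomial b f ≠ 0) :
    Y.cotangentMap (b.coord i₀) ≠ 0 := by
  obtain ⟨rfl, hf'⟩ := eq_one_of_sum_neg_eq hinj hℓ hind hf
  rwa [grMonomial_one, hf'] at h0

theorem cotangentMap_mem (hb : ∀ i, b i ∈ weightSpace ρ (β i)) (i : Fin d) :
    Y.cotangentMap (b.coord i) ∈ weightSpace (Y.grRep 1) (-β i) := by
  have h := Y.grMonomial_mem hb fun _ : Fin 1 => i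
  rwa [grMonomial_one, Fin.sum_univ_one] at h

theorem mem_weights_coneRep_iff (hb : ∀ i, b i ∈ weightSpace ρ (β i))
    (hinj : Function.Injective β) (hℓ : ∀ i, 0 < ℓ (β i)) {i₀ : Fin d}
    (hind : ¬ IntegrallyDecomposable (Set.range β) (β i₀)) :
    -β i₀ ∈ weights Y.coneRep ↔ Y.cotangentMap (b.coord i₀) ≠ 0 := by
  constructor
  · intro h
    obtain ⟨c, hc, hc0⟩ := (Submodule.ne_bot_iff _).1 h
    obtain ⟨k, hk⟩ : ∃ k, c k ≠ 0 := by
      by_contra! h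
      exact hc0 (DFinsupp.ext h)
    have hck : c k ∈ weightSpace (Y.grRep k) (-β i₀) := by
      intro t
      have h1 := congrArg (fun c : Y.coneRing => c k) (hc t)
      exact h1
    obtain ⟨f, hf, hf0⟩ := exists_of_mem_weightSpace (Y.isRational_grRep hb k)
      (fun f => Y.grMonomial_mem hb f) (Y.span_grMonomial b k (c k)) hck hk
    exact Y.cotangentMap_ne_zero hinj hℓ hind hf hf0
  · intro h
    refine (Submodule.ne_bot_iff _).2
      ⟨DirectSum.lof ℂ ℕ Y.grPiece 1 (Y.cotangentMap (b.coord i₀)), fun t => ?_, fun h0 => h ?_⟩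
    · have h1 := Y.cotangentMap_mem hb i₀ t
      change DirectSum.lmap (fun i => Y.grRep i t) _ = _
      rw [DirectSum.lmap_lof, h1, map_smul]
    · exact DirectSum.of_injective (β := Y.grPiece) 1 (h0.trans (map_zero _).symm)

theorem mem_weights_tangentRep_iff (hb : ∀ i, b i ∈ weightSpace ρ (β i))
    (hinj : Function.Injective β) (hℓ : ∀ i, 0 < ℓ (β i)) {i₀ : Fin d}
    (hind : ¬ IntegrallyDecomposable (Set.range β) (β i₀)) :
    β i₀ ∈ weights Y.tangentRep ↔ Y.cotangentMap (b.coord i₀) ≠ 0 := by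
  constructor
  · intro h
    obtain ⟨ξ, hξ, hξ0⟩ := (Submodule.ne_bot_iff _).1 h
    obtain ⟨f, hf⟩ : ∃ f : Fin 1 → Fin d, ξ (Y.grMonomial b f) ≠ 0 := by
      by_contra! h0
      apply hξ0
      have h1 : ∀ y ∈ Submodule.span ℂ (Set.range fun f : Fin 1 → Fin d => Y.grMonomial b f),
          ξ y = 0 := by
        intro y hy
        have hle : Submodule.span ℂ (Set.range fun f : Fin 1 → Fin d => Y.grMonomial b f) ≤
            LinearMap.ker ξ := by
          rw [Submodule.span_le]
          rintro _ ⟨f, rfl⟩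
          exact h0 f
        exact hle hy
      exact LinearMap.ext fun y => h1 y (Y.span_grMonomial b 1 y)
    refine Y.cotangentMap_ne_zero hinj hℓ hind (f := f) ?_ fun h0 => hf (by rw [h0, map_zero])
    -- A functional of weight α that is nonzero on a weight vector forces that vector to have weight
    -- -α.
    rw [← neg_inj, neg_neg]
    refine expChar_eq_of_forall fun t => ?_
    have h1 := LinearMap.congr_fun (hξ t) (Y.grMonomial b f)
    have h2 : Y.tangentRep t ξ (Y.grMonomial b f) = ξ (Y.grRep 1 t⁻¹ (Y.grMonomial b f)) := rfl
    rw [h2, Y.grMonomial_mem hb f t⁻¹, map_smul, LinearMap.smul_apply, ← expChar_neg_inv] at h1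
    exact mul_right_cancel₀ hf h1
  · intro h
    have hrat := Y.isRational_grRep hb 1
    have hmem := Y.cotangentMap_mem hb i₀
    obtain ⟨ξ, hξ⟩ : ∃ ξ : Module.Dual ℂ (Y.grPiece 1), ξ (Y.cotangentMap (b.coord i₀)) ≠ 0 := by
      by_contra! h0
      exact h ((Module.forall_dual_apply_eq_zero_iff ℂ _).1 h0)
    -- Precomposing with the projection to weight -α makes an arbitrary functional into one of
    -- weight α, without changing its value on the class of `x_α`.
    refine (Submodule.ne_bot_iff _).2 ⟨ξ ∘ₗ weightProj hrat (-β i₀), fun t => ?_, fun h0 => hξ ?_⟩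
    · refine LinearMap.ext fun y => ?_
      change ξ (weightProj hrat (-β i₀) (Y.grRep 1 t⁻¹ y)) =
        (expChar (β i₀) t : ℂ) • ξ (weightProj hrat (-β i₀) y)
      have h1 : weightProj hrat (-β i₀) (Y.grRep 1 t⁻¹ y) =
          Y.grRep 1 t⁻¹ (weightProj hrat (-β i₀) y) := by
        have h2 : ShiftEquivariant (Y.grRep 1) (Y.grRep 1) 0 (Y.grRep 1 t⁻¹) :=
          ShiftEquivariant.of_equivariant fun s m => by
            rw [← Module.End.mul_apply, ← Module.End.mul_apply, ← map_mul, ← map_mul, mul_comm]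
        rw [h2.weightProj_map hrat hrat, sub_zero]
      rw [h1, weightProj_mem hrat (-β i₀) y t⁻¹, map_smul, ← expChar_neg_inv, neg_neg]
    · have h1 := LinearMap.congr_fun h0 (Y.cotangentMap (b.coord i₀))
      rwa [LinearMap.comp_apply, weightProj_of_mem hrat hmem] at h1

/-! ### Simple factors -/

variable [FiniteDimensional ℂ V]

theorem isSimpleFactor_iff (hρ : IsRational ρ) (hb : ∀ i, b i ∈ weightSpace ρ (β i))
    (hinj : Function.Injective β) (hℓ : ∀ i, 0 < ℓ (β i)) {i₀ : Fin d}
    (hind : ¬ IntegrallyDecomposable (Set.range β) (β i₀)) :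
    IsSimpleFactor (Set.range β) (β i₀) ((Y.structureSheaf hρ).eulerClass hb hℓ) ↔
      coordX b i₀ ∈ Y.ideal := by
  classical
  have hprod : eulerProd β Finset.univ =
      (1 - expR (-β i₀)) * eulerProd β (Finset.univ.erase i₀) :=
    (Finset.mul_prod_erase Finset.univ _ (Finset.mem_univ i₀)).symm
  constructor
  · rintro ⟨Q, hQ, hPQ⟩
    by_contra hx
    rw [mem_expSubring_iff hinj] at hQ
    have hbd := (Y.structureSheaf hρ).boundedSupport_charFun hb hℓ
    have hc := (Y.structureSheaf hρ).coeff_eulerClass hb hℓ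
    rw [hPQ, hprod, map_mul, Module.End.mul_apply, ← convAct_coeff, ← sub_eq_zero, ← map_sub] at hc
    have hbd' : BoundedSupport ℓ (convAct n (eulerProd β (Finset.univ.erase i₀))
        (charFun (Y.structureSheaf hρ).rep)) := by
      have : ∀ s : Finset (Fin d), BoundedSupport ℓ (convAct n (eulerProd β s)
          (charFun (Y.structureSheaf hρ).rep)) := by
        intro s
        induction s using Finset.induction_on with
        | empty => simpa [eulerProd] using hbd
        | insert i s hi ih =>
          rw [eulerProd, Finset.prod_insert hi, map_mul, Module.End.mul_apply]
          exact ih.one_sub_expR _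
      exact this _
    -- Cancellation of 1 - e^{-α}: the difference of `Q` and the product over β ≠ α applied to char
    -- ℂ[Y] is annihilated by it and has bounded support, so it vanishes.
    have hzero := support_of_one_sub_expR ((boundedSupport_coeff Q).sub hbd') (hℓ i₀) (W := ∅)
      (fun _ h => h) fun μ hμ => hμ (congrFun hc μ)
    have heq : ∀ μ, convAct n (eulerProd β (Finset.univ.erase i₀))
        (charFun (Y.structureSheaf hρ).rep) μ = Q.coeff μ := by
      intro μ
      by_contra h
      exact hzero μ fun h' => h (sub_eq_zero.1 h').symm
    -- Dividing by the remaining factors stays in the cone, so every weight of ℂ[Y] lies there. But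
    -- -α does not, although `x_α` would be a nonzero vector of that weight.
    have hsupp := support_of_eulerProd (β := β) (s := Finset.univ.erase i₀) (fun i _ => hℓ i)
      (W := negCone β i₀) (fun i hi μ hμ => by
        have h1 : -β i ∈ negCone β i₀ :=
          AddSubmonoid.subset_closure ⟨i, Finset.ne_of_mem_erase hi, rfl⟩
        have h2 := add_mem hμ h1
        rwa [add_neg_cancel_right] at h2) hbd fun μ hμ => hQ μ (by rwa [heq] at hμ)
    refine neg_notMem_negCone hinj hℓ hind (hsupp _ fun h => ?_)
    have hfd := (Y.structureSheaf hρ).finiteDimensional_weightSpace hb hℓ (-β i₀)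
    have h1 : weightSpace (Y.structureSheaf hρ).rep (-β i₀) = ⊥ :=
      Submodule.finrank_eq_zero.1 (Nat.cast_eq_zero.1 h)
    have h2 : (Ideal.Quotient.mk Y.ideal (coordX b i₀) : Y.ring) ∈
      weightSpace (Y.structureSheaf hρ).rep (-β i₀) := Y.mk_mem_weightSpace (coordX_mem b hb i₀)
    rw [h1] at h2
    exact hx (Ideal.Quotient.eq_zero_iff_mem.1 h2)
  · intro hx
    have hmono : ∀ a : Fin d → ℕ, a i₀ ≠ 0 → coordMonomial b a ∈ Y.ideal := by
      intro a ha
      obtain ⟨k, hk⟩ := Nat.exists_eq_succ_of_ne_zero ha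
      rw [coordMonomial, ← Finset.mul_prod_erase _ _ (Finset.mem_univ i₀), hk, pow_succ', mul_assoc]
      exact Ideal.mul_mem_right _ _ hx
    have hspan : ∀ g : Y.ring, g ∈ Submodule.span ℂ
        (Set.range fun a => Ideal.Quotient.mk Y.ideal (coordMonomial b a)) := by
      intro g
      obtain ⟨f, rfl⟩ := Ideal.Quotient.mk_surjective g
      have h1 : (Ideal.Quotient.mkₐ ℂ Y.ideal).toLinearMap f ∈
          (Submodule.span ℂ (Set.range (coordMonomial b))).map
            (Ideal.Quotient.mkₐ ℂ Y.ideal).toLinearMap :=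
        ⟨f, by rw [span_coordMonomial]; trivial, rfl⟩
      rw [Submodule.map_span, ← Set.range_comp] at h1
      exact h1
    -- Since `x_α` acts by zero on ℂ[Y], the product over β ≠ α already clears denominators; the
    -- surviving monomials do not involve `x_α`, so all weights lie in the cone.
    obtain ⟨Q, hQ, hQW⟩ := (Y.structureSheaf hρ).exists_eulerProd_charFun hb hℓ (negCone β i₀)
      (Finset.univ.erase i₀)
      (fun i hi => AddSubmonoid.subset_closure ⟨i, Finset.ne_of_mem_erase hi, rfl⟩)
      (fun i hi m => by
        have : i = i₀ := by simpa using hi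
        subst this
        obtain ⟨f, rfl⟩ := Ideal.Quotient.mk_surjective m
        exact Ideal.Quotient.eq_zero_iff_mem.2 (Ideal.mul_mem_right f _ hx))
      (fun μ hμ => by
        have h : weightSpace (algRep Y.act) μ ≠ ⊥ := by
          intro h
          apply hμ
          have h' : weightSpace (Y.structureSheaf hρ).rep μ = ⊥ := h
          rw [charFun, h', finrank_bot, Nat.cast_zero]
        obtain ⟨g, hg, hg0⟩ := (Submodule.ne_bot_iff _).1 h
        obtain ⟨a, rfl, ha0⟩ := exists_of_mem_weightSpace (Y.structureSheaf hρ).rational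
          (fun a => Y.mk_mem_weightSpace (coordMonomial_mem b hb a)) (hspan g) hg hg0
        refine sum_mem fun i _ => ?_
        by_cases hi : i = i₀
        · have : a i = 0 := by
            by_contra h0
            exact ha0 (Ideal.Quotient.eq_zero_iff_mem.2 (hmono a (hi ▸ h0)))
          rw [this, zero_smul]
          exact AddSubmonoid.zero_mem _
        · exact nsmul_mem (AddSubmonoid.subset_closure (Set.mem_image_of_mem _ hi)) _)
    refine ⟨Q, (mem_expSubring_iff hinj Q).2 hQW, ?_⟩
    apply AddMonoidAlgebra.coeff_injective
    apply DFunLike.coe_injective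
    rw [EquivModule.coeff_eulerClass, hprod, map_mul, Module.End.mul_apply, ← convAct_coeff, hQ]

end StableSubscheme

end

/-! ### The main theorem -/

theorem proposition3 {n : ℕ} {V : Type u} [AddCommGroup V] [Module ℂ V] [FiniteDimensional ℂ V]
    (ρ : Representation ℂ (Torus n) V) (hρ : IsRational ρ)
    (hone : ∀ β ∈ weights ρ, Module.finrank ℂ (weightSpace ρ β) = 1)
    (hhalf : InHalfSpace (weights ρ))
    (Y : StableSubscheme ρ)
    (α : CharGroup n) (hα : α ∈ weights ρ)
    (hind : ¬ IntegrallyDecomposable (weights ρ) α)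
    (x : Module.Dual ℂ V) (hx : x ∈ weightSpace ρ.dual (-α)) (hx0 : x ≠ 0) :
    (∃! iStar : KGroup ρ →+ RepRing n, IsPullbackToOrigin iStar) ∧
    ∀ iStar : KGroup ρ →+ RepRing n, IsPullbackToOrigin iStar →
      List.TFAE
        [α ∈ weights Y.tangentRep,
         Y.toTangentRing x ≠ 0,
         Y.toConeRing x ≠ 0,
         -α ∈ weights Y.coneRep,
         ¬ IsSimpleFactor (weights ρ) α (iStar (Y.structureSheaf hρ).kClass)] := by
  obtain ⟨ℓ, hℓ'⟩ := hhalf.exists_addMonoidHom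
  obtain ⟨d, b, β, hinj, hrange, hb⟩ := exists_weight_basis hρ hone
  rw [← hrange] at hα hind hℓ' ⊢
  obtain ⟨i₀, rfl⟩ := hα
  have hℓ : ∀ i, 0 < ℓ (β i) := fun i => hℓ' _ ⟨i, rfl⟩
  have hpull := EquivModule.isPullbackToOrigin_pullbackHom (ρ := ρ) hb hℓ
  refine ⟨⟨_, hpull, fun g hg => EquivModule.pullback_unique hρ hb hℓ hg hpull⟩,
    fun iStar hiStar => ?_⟩
  -- By uniqueness any pullback is the Euler class construction, so condition (v) says that `x_α` is
  -- not in the ideal of Y.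
  rw [EquivModule.pullback_unique hρ hb hℓ hiStar hpull, EquivModule.pullbackHom_kClass,
    Y.isSimpleFactor_iff hρ hb hinj hℓ hind, Y.mem_weights_tangentRep_iff hb hinj hℓ hind,
    Y.mem_weights_coneRep_iff hb hinj hℓ hind]
  -- The weights `β j` are distinct, so a functional of weight -α kills every basis vector except `b
  -- i₀`.
  obtain ⟨c, hc, rfl⟩ : ∃ c : ℂ, c ≠ 0 ∧ x = c • b.coord i₀ := by
    have hxj : ∀ j, j ≠ i₀ → x (b j) = 0 := by
      intro j hj
      by_contra h0
      refine hj (hinj (neg_injective (expChar_eq_of_forall fun t => ?_)))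
      have h1 := LinearMap.congr_fun (hx t) (b j)
      have h2 : ρ.dual t x (b j) = x (ρ t⁻¹ (b j)) := rfl
      rw [h2, hb j t⁻¹, map_smul, LinearMap.smul_apply, ← expChar_neg_inv] at h1
      exact mul_right_cancel₀ h0 h1
    have hxc : x = x (b i₀) • b.coord i₀ := by
      refine b.ext fun j => ?_
      by_cases hj : j = i₀
      · subst hj; simp
      · simp [hxj j hj, hj]
    exact ⟨x (b i₀), fun h => hx0 (by rw [hxc, h, zero_smul]), hxc⟩
  have hcot : Y.cotangentMap (c • b.coord i₀) = 0 ↔ Y.cotangentMap (b.coord i₀) = 0 := by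
    rw [map_smul, smul_eq_zero, or_iff_right hc]
  have hB : Y.toTangentRing (c • b.coord i₀) = 0 ↔ Y.cotangentMap (b.coord i₀) = 0 := by
    rw [← hcot]
    exact map_eq_zero_iff _ SymmetricAlgebra.ι_injective_of_comm
  have hC : Y.toConeRing (c • b.coord i₀) = 0 ↔ Y.cotangentMap (b.coord i₀) = 0 := by
    rw [← hcot]
    exact map_eq_zero_iff (DirectSum.lof ℂ ℕ Y.grPiece 1)
      (DirectSum.of_injective (β := Y.grPiece) 1)
  have hI : coordX b i₀ ∈ Y.ideal ↔ Y.cotangentMap (b.coord i₀) = 0 :=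
    ⟨Y.cotangentMap_eq_zero_of_mem, Y.coordX_mem_ideal hρ hb hinj hℓ hind⟩
  rw [Ne, Ne, Ne, hB, hC, hI]
  tfae_finish
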